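/- Let $V=\Lambda^3(\mathbb{C}^7)^*$, let $\eta$ be the standard non-degenerate symmetric bilinear form on $\mathbb{C}^7$, extended to $V$ so that the forms $e^{ijk}=e^i\wedge e^j\wedge e^k$, $i<j<k$, are orthonormal, and let $\beta\mapsto\beta^\sharp$ be the induced musical isomorphism $V\to\Lambda^3\mathbb{C}^7$. Let $\bullet:\Lambda^3\mathbb{C}^7\otimes\Lambda^3(\mathbb{C}^7)^*\to\mathfrak{sl}(7,\mathbb{C})$ be the $\mathfrak{sl}(7,\mathbb{C})$-equivariant map normalized by $$e_{123}\bullet e^{123}=\tfrac47\sum_{i=1}^{3}e_i\otimes e^i-\tfrac37\sum_{j=4}^{7}e_j\otimes e^j ,$$ and let $A\cdot\gamma$ denote the natural (dual) action of $A\in\mathfrak{sl}(7,\mathbb{C})$ on $\gamma\in V$. A Kantor triple system is a complex vector space with a trilinear product satisfying (i) $(uv(xyz))=((uvx)yz)-(x(vuy)z)+(xy(uvz))$ and (ii) $K_{K_{uv}(x)y}=K_{(yxu)v}-K_{(yxv)u}$, where $K_{xy}(z)=(xzy)-(yzx)$. It is $K$-simple if its product is non-zero and its only subspaces $I$ with $(VVI)+(IVV)\subset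 I$ are $0$ and $V$. Its Tits-Kantor-Koecher Lie algebra is the $5$-graded Lie algebra $\mathfrak{g}=\mathfrak{g}_{-2}\oplus\cdots\oplus\mathfrak{g}_2$ with $\mathfrak{g}_{-1}=V$ and with a grade-reversing involution $\sigma$ such that $(xyz)=[[x,\sigma(y)],z]$, given by the standard embedding of the Lie triple system $\mathfrak{g}_{-1}\oplus\mathfrak{g}_1=V\oplus\sigma(V)$: its even part $\mathfrak{g}_{-2}\oplus\mathfrak{g}_0\oplus\mathfrak{g}_2=[\mathfrak{g}_{-1}\oplus\mathfrak{g}_1,\mathfrak{g}_{-1}\oplus\mathfrak{g}_1]$ acts faithfully on $\mathfrak{g}_{-1}\oplus\mathfrak{g}_1$. For $x,y,z\in V$ the bracket satisfies $[[x,y],z]=0$, $[[x,y],\sigma(z)]=\sigma([[\sigma(x),\sigma(y)],z])=K_{xy}(z)$, $[[x,\sigma(y)],z]=(xyz)$ and $[[x,\sigma(y)],\sigma(z)]=-\sigma((yxz))$. **Theorem.** The vector space $V=\Lambda^3(\mathbb{C}^7)^*$ with the product $$(\alpha\beta\gamma)=\tfrac27\,\eta(\alpha,\beta)\,\gamma-(\beta^\sharp\bullet\alpha)\cdot\gamma$$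 is a $K$-simple Kantor triple system. Its Tits-Kantor-Koecher Lie algebra is the simple complex Lie algebra of type $E_7$, that is, it is finite-dimensional and semisimple and its root system has Cartan matrix $E_7$. Its Lie algebra of derivations is $\mathfrak{der}(V)=\mathfrak{stab}_{\mathfrak{sl}(7,\mathbb{C})}(\eta)$, i.e. $A\mapsto(\alpha\mapsto A\cdot\alpha)$ is a Lie algebra isomorphism from $\mathfrak{stab}_{\mathfrak{sl}(7,\mathbb{C})}(\eta)$ onto $\mathfrak{der}(V)$, and $\mathfrak{stab}_{\mathfrak{sl}(7,\mathbb{C})}(\eta)\simeq\mathfrak{so}(7,\mathbb{C})$. -/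

import Mathlib

open scoped Matrix

attribute [local instance 100] LieRing.ofAssociativeRing

noncomputable section

/-! ### Kantor triple systems -/

/-- The Kantor tensor `K_{xy}(z) = (xzy) - (yzx)` of a trilinear product. -/
def kantorTensor {V : Type*} [AddCommGroup V] [Module ℂ V]
    (t : V →ₗ[ℂ] V →ₗ[ℂ] V →ₗ[ℂ] V) : V →ₗ[ℂ] V →ₗ[ℂ] Module.End ℂ V :=
  LinearMap.mk₂ ℂ (fun x y => (t x).flip y - (t y).flip x)
    (fun x x' y => by ext z; simp; abel) (fun c x y => by ext z; simp [smul_sub])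
    (fun x y y' => by ext z; simp; abel) (fun c x y => by ext z; simp [smul_sub])

theorem kantorTensor_apply {V : Type*} [AddCommGroup V] [Module ℂ V]
    (t : V →ₗ[ℂ] V →ₗ[ℂ] V →ₗ[ℂ] V) (x y z : V) :
    kantorTensor t x y z = t x z y - t y z x := rfl

/-- A Kantor triple system: a complex vector space `V` with a trilinear product
`(xyz) = triple x y z` satisfying
(i) `(uv(xyz)) = ((uvx)yz) - (x(vuy)z) + (xy(uvz))`,
(ii) `K_{K_{uv}(x)y} = K_{(yxu)v} - K_{(yxv)u}`. -/
structure KantorTripleSystem (V : Type*) [AddCommGroup V] [Module ℂ V] where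
  triple : V →ₗ[ℂ] V →ₗ[ℂ] V →ₗ[ℂ] V
  triple_triple : ∀ u v x y z : V,
    triple u v (triple x y z) =
      triple (triple u v x) y z - triple x (triple v u y) z + triple x y (triple u v z)
  kantor_kantor : ∀ u v x y : V,
    kantorTensor triple (kantorTensor triple u v x) y =
      kantorTensor triple (triple y x u) v - kantorTensor triple (triple y x v) u

namespace KantorTripleSystem

variable {V : Type*} [AddCommGroup V] [Module ℂ V] (T : KantorTripleSystem V)

/-- A `K`-ideal: a subspace `I` with `(VVI) + (IVV) ⊆ I`. -/
def IsKIdeal (I : Submodule ℂ V) : Prop :=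
  ∀ x y : V, ∀ z ∈ I, T.triple x y z ∈ I ∧ T.triple z x y ∈ I

/-- `K`-simple: the product is not identically zero, and the only `K`-ideals are `0` and `V`. -/
def IsKSimple : Prop :=
  T.triple ≠ 0 ∧ ∀ I : Submodule ℂ V, T.IsKIdeal I → I = ⊥ ∨ I = ⊤

/-- The Lie algebra `𝔡𝔢𝔯(V)` of derivations, as a Lie subalgebra of `𝔤𝔩(V)`. -/
def der : LieSubalgebra ℂ (Module.End ℂ V) where
  carrier := {δ | ∀ x y z : V, δ (T.triple x y z) =
    T.triple (δ x) y z + T.triple x (δ y) z + T.triple x y (δ z)}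
  add_mem' {a b} ha hb x y z := by
    simp only [Set.mem_ofPred_eq] at ha hb
    simp only [LinearMap.add_apply, map_add, ha, hb]; abel
  zero_mem' x y z := by simp
  smul_mem' c a ha x y z := by
    simp only [Set.mem_ofPred_eq] at ha
    simp [ha, smul_add]
  lie_mem' {a b} ha hb x y z := by
    replace ha : ∀ x y z : V, a (T.triple x y z) =
      T.triple (a x) y z + T.triple x (a y) z + T.triple x y (a z) := ha
    replace hb : ∀ x y z : V, b (T.triple x y z) =
      T.triple (b x) y z + T.triple x (b y) z + T.triple x y (b z) := hb
    simp only [Ring.lie_def, LinearMap.sub_apply, Module.End.mul_apply, ha, hb, map_add, map_sub]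
    abel

/-! ### The Tits-Kantor-Koecher Lie algebra

The 5-graded Lie algebra `𝔤 = 𝔤₋₂ ⊕ 𝔤₋₁ ⊕ 𝔤₀ ⊕ 𝔤₁ ⊕ 𝔤₂` with grade-reversing involution `σ`
such that `𝔤₋₁ = V`, `𝔤₁ = σ(V)` and `(xyz) = [[x, σy], z]`. It is built as the standard embedding
of the Lie triple system `𝔤₋₁ ⊕ 𝔤₁` with product `[[t, s], u]`. An element `x + σ(x')` of
`𝔤₋₁ ⊕ 𝔤₁` is written as the pair `(x, x')`, and
`𝔤₋₂ ⊕ 𝔤₀ ⊕ 𝔤₂ = [𝔤₋₁ ⊕ 𝔤₁, 𝔤₋₁ ⊕ 𝔤₁]` is realized faithfully by `2 × 2` block operators on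
`V × V`:
* `𝔤₋₂` is spanned by `[x, y] ↔ (0, K_{xy}; 0, 0)`,
* `𝔤₀` is spanned by `[x, σy] ↔ (L_{xy}, 0; 0, -L_{yx})`, where `L_{xy}(z) = (xyz)`,
* `𝔤₂` is spanned by `[σx, σy] ↔ (0, 0; K_{xy}, 0)`. -/

/-- The operator by which `[x + σ(x'), y + σ(y')]` acts on `𝔤₋₁ ⊕ 𝔤₁ = V × V`, for `p = (x, x')`
and `q = (y, y')`, as the block matrix
`(L_{xy'} - L_{yx'}, K_{xy}; K_{x'y'}, L_{x'y} - L_{y'x})`. -/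
def bracketOp : (V × V) →ₗ[ℂ] (V × V) →ₗ[ℂ] Module.End ℂ (V × V) :=
  LinearMap.mk₂ ℂ
    (fun p q => LinearMap.prod
      ((T.triple p.1 q.2 - T.triple q.1 p.2).comp (LinearMap.fst ℂ V V) +
        (kantorTensor T.triple p.1 q.1).comp (LinearMap.snd ℂ V V))
      ((kantorTensor T.triple p.2 q.2).comp (LinearMap.fst ℂ V V) +
        (T.triple p.2 q.1 - T.triple q.2 p.1).comp (LinearMap.snd ℂ V V)))
    (fun p p' q => by ext z <;> simp [kantorTensor_apply] <;> abel)
    (fun c p q => by ext z <;> simp [kantorTensor_apply, smul_sub])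
    (fun p q q' => by ext z <;> simp [kantorTensor_apply] <;> abel)
    (fun c p q => by ext z <;> simp [kantorTensor_apply, smul_sub])

theorem bracketOp_apply (p q r : V × V) :
    T.bracketOp p q r =
      (T.triple p.1 q.2 r.1 - T.triple q.1 p.2 r.1 + kantorTensor T.triple p.1 q.1 r.2,
        kantorTensor T.triple p.2 q.2 r.1 + (T.triple p.2 q.1 r.2 - T.triple q.2 p.1 r.2)) := rfl

theorem bracketOp_skew (p q : V × V) : T.bracketOp p q = -T.bracketOp q p := by
  ext z <;> simp [bracketOp_apply, kantorTensor_apply]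

theorem bracketOp_cyclic (p q r : V × V) :
    T.bracketOp p q r + T.bracketOp q r p + T.bracketOp r p q = 0 := by
  ext <;> simp [bracketOp_apply, kantorTensor_apply] <;> abel

theorem triple_kantor (u v x y z : V) :
    T.triple u v (kantorTensor T.triple x y z) + kantorTensor T.triple x y (T.triple v u z) =
      kantorTensor T.triple (T.triple u v x) y z + kantorTensor T.triple x (T.triple u v y) z := by
  simp only [kantorTensor_apply, map_sub, T.triple_triple u v]; abel

theorem kantor_triple (u v x y z : V) :
    T.triple y x (kantorTensor T.triple u v z) + kantorTensor T.triple u v (T.triple x y z) =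
      kantorTensor T.triple (kantorTensor T.triple u v x) y z := by
  rw [T.kantor_kantor, T.triple_kantor y x u v z]
  simp only [kantorTensor_apply, LinearMap.sub_apply]; abel

theorem kantor_comp_kantor (u v x y z : V) :
    kantorTensor T.triple u v (kantorTensor T.triple x y z) =
      T.triple (kantorTensor T.triple u v x) y z - T.triple (kantorTensor T.triple u v y) x z := by
  have h1 := T.kantor_triple u v x z y
  have h2 := T.kantor_triple u v y z x
  rw [kantorTensor_apply _ (kantorTensor T.triple u v x)] at h1
  rw [kantorTensor_apply _ (kantorTensor T.triple u v y)] at h2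
  rw [kantorTensor_apply _ x y z, map_sub]
  rw [← sub_eq_zero] at h1 h2 ⊢
  rw [← sub_eq_zero.mpr (h1.trans h2.symm)]
  abel

theorem kantor_comp_kantor' (u v x y z : V) :
    kantorTensor T.triple u v (kantorTensor T.triple x y z) =
      T.triple v (kantorTensor T.triple x y u) z - T.triple u (kantorTensor T.triple x y v) z := by
  rw [T.kantor_comp_kantor]
  simp only [kantorTensor_apply, map_sub, LinearMap.sub_apply]
  linear_combination (norm := module)
    T.triple_triple v x u y z - T.triple_triple v y u x z
      - T.triple_triple u x v y z + T.triple_triple u y v x z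

theorem kantor_skew (x y z : V) :
    kantorTensor T.triple x y z = -kantorTensor T.triple y x z := by
  simp [kantorTensor_apply]

theorem bracketOp_lie (p q t s : V × V) :
    ⁅T.bracketOp p q, T.bracketOp t s⁆ =
      T.bracketOp (T.bracketOp p q t) s + T.bracketOp t (T.bracketOp p q s) := by
  apply LinearMap.ext
  rintro ⟨z, z'⟩
  obtain ⟨a, a'⟩ := p
  obtain ⟨b, b'⟩ := q
  obtain ⟨x, x'⟩ := t
  obtain ⟨y, y'⟩ := s
  simp only [Ring.lie_def, LinearMap.sub_apply, LinearMap.add_apply, Module.End.mul_apply,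
    bracketOp_apply, Prod.mk_sub_mk, Prod.mk_add_mk, Prod.mk.injEq]
  simp only [map_add, map_sub, LinearMap.add_apply, LinearMap.sub_apply]
  constructor
  · linear_combination (norm := module)
      T.triple_triple a b' x y' z
      - T.triple_triple a b' y x' z
      - T.triple_triple b a' x y' z
      + T.triple_triple b a' y x' z
      + T.kantor_comp_kantor a b x' y' z
      - T.kantor_comp_kantor' x y a' b' z
      + T.triple_kantor a b' x y z'
      - T.triple_kantor b a' x y z'
      + T.kantor_triple a b x' y z'
      - T.kantor_triple a b y' x z'
      - T.kantor_skew x (kantorTensor T.triple a b y') z'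
  · linear_combination (norm := module)
      T.triple_triple a' b x' y z'
      - T.triple_triple a' b y' x z'
      - T.triple_triple b' a x' y z'
      + T.triple_triple b' a y' x z'
      + T.kantor_comp_kantor a' b' x y z'
      - T.kantor_comp_kantor' x' y' a b z'
      + T.triple_kantor a' b x' y' z
      - T.triple_kantor b' a x' y' z
      + T.kantor_triple a' b' x y' z
      - T.kantor_triple a' b' y x' z
      - T.kantor_skew x' (kantorTensor T.triple a' b' y) z

/-- The Lie algebra `𝔤₋₂ ⊕ 𝔤₀ ⊕ 𝔤₂` of block operators: the linear span of the operators
`[t, s]`, for `t`, `s` in `𝔤₋₁ ⊕ 𝔤₁`, with the commutator bracket. -/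
def evenPart : LieSubalgebra ℂ (Module.End ℂ (V × V)) where
  __ := Submodule.span ℂ {A | ∃ t s : V × V, T.bracketOp t s = A}
  lie_mem' {A B} hA hB := by
    change A ∈ Submodule.span ℂ {A | ∃ t s : V × V, T.bracketOp t s = A} at hA
    change B ∈ Submodule.span ℂ {A | ∃ t s : V × V, T.bracketOp t s = A} at hB
    change ⁅A, B⁆ ∈ Submodule.span ℂ {A | ∃ t s : V × V, T.bracketOp t s = A}
    induction hA, hB using Submodule.span_induction₂ with
    | mem_mem A B hA hB =>
      obtain ⟨p, q, rfl⟩ := hA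
      obtain ⟨t, s, rfl⟩ := hB
      rw [bracketOp_lie]
      exact add_mem (Submodule.subset_span ⟨_, _, rfl⟩) (Submodule.subset_span ⟨_, _, rfl⟩)
    | zero_left => simp
    | zero_right => simp
    | add_left _ _ _ _ _ _ h1 h2 => rw [add_lie]; exact add_mem h1 h2
    | add_right _ _ _ _ _ _ h1 h2 => rw [lie_add]; exact add_mem h1 h2
    | smul_left c _ _ _ _ h => rw [smul_lie]; exact Submodule.smul_mem _ c h
    | smul_right c _ _ _ _ h => rw [lie_smul]; exact Submodule.smul_mem _ c h

theorem bracketOp_mem (t s : V × V) : T.bracketOp t s ∈ T.evenPart :=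
  Submodule.subset_span ⟨t, s, rfl⟩

theorem lie_bracketOp {A : Module.End ℂ (V × V)} (hA : A ∈ T.evenPart) (t s : V × V) :
    ⁅A, T.bracketOp t s⁆ = T.bracketOp (A t) s + T.bracketOp t (A s) := by
  change A ∈ Submodule.span ℂ {A | ∃ t s : V × V, T.bracketOp t s = A} at hA
  induction hA using Submodule.span_induction with
  | mem A hA => obtain ⟨p, q, rfl⟩ := hA; exact T.bracketOp_lie p q t s
  | zero => simp
  | add A B _ _ h1 h2 => rw [add_lie, h1, h2]; simp only [LinearMap.add_apply, map_add]; abel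
  | smul c A _ h => rw [smul_lie, h]; simp [smul_add]

/-- The Tits-Kantor-Koecher Lie algebra `𝔤 = (𝔤₋₂ ⊕ 𝔤₀ ⊕ 𝔤₂) ⊕ (𝔤₋₁ ⊕ 𝔤₁)`. -/
@[ext]
structure TKK where
  even : T.evenPart
  odd : V × V

namespace TKK

variable {T}

instance : Zero T.TKK := ⟨⟨0, 0⟩⟩
instance : Add T.TKK := ⟨fun a b => ⟨a.even + b.even, a.odd + b.odd⟩⟩
instance : Neg T.TKK := ⟨fun a => ⟨-a.even, -a.odd⟩⟩
instance : Sub T.TKK := ⟨fun a b => ⟨a.even - b.even, a.odd - b.odd⟩⟩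
instance {R : Type*} [SMul R T.evenPart] [SMul R V] : SMul R T.TKK :=
  ⟨fun c a => ⟨c • a.even, c • a.odd⟩⟩

/-- The underlying pair of an element. -/
def toProd (a : T.TKK) : T.evenPart × (V × V) := (a.even, a.odd)

theorem toProd_injective : Function.Injective (toProd : T.TKK → T.evenPart × (V × V)) := by
  rintro ⟨a, t⟩ ⟨b, s⟩ h
  simp only [toProd, Prod.mk.injEq] at h
  exact TKK.ext h.1 h.2

instance : AddCommGroup T.TKK :=
  toProd_injective.addCommGroup toProd rfl (fun _ _ => rfl) (fun _ => rfl) (fun _ _ => rfl)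
    (fun _ _ => rfl) (fun _ _ => rfl)

instance : Module ℂ T.TKK :=
  toProd_injective.module ℂ ⟨⟨toProd, rfl⟩, fun _ _ => rfl⟩ (fun _ _ => rfl)

/-- `[A + t, B + s] = ([A, B] + [t, s]) + (A s - B t)`. -/
instance : Bracket T.TKK T.TKK :=
  ⟨fun a b => ⟨⁅a.even, b.even⁆ + ⟨T.bracketOp a.odd b.odd, T.bracketOp_mem _ _⟩,
    a.even.1 b.odd - b.even.1 a.odd⟩⟩

@[simp] theorem add_even (a b : T.TKK) : (a + b).even = a.even + b.even := rfl
@[simp] theorem add_odd (a b : T.TKK) : (a + b).odd = a.odd + b.odd := rfl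
@[simp] theorem zero_even : (0 : T.TKK).even = 0 := rfl
@[simp] theorem zero_odd : (0 : T.TKK).odd = 0 := rfl
@[simp] theorem smul_even (c : ℂ) (a : T.TKK) : (c • a).even = c • a.even := rfl
@[simp] theorem smul_odd (c : ℂ) (a : T.TKK) : (c • a).odd = c • a.odd := rfl
theorem add_even_coe (a b : T.TKK) : ((a + b).even : Module.End ℂ (V × V)) =
    (a.even : Module.End ℂ (V × V)) + (b.even : Module.End ℂ (V × V)) := rfl
theorem smul_even_coe (c : ℂ) (a : T.TKK) : ((c • a).even : Module.End ℂ (V × V)) =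
    c • (a.even : Module.End ℂ (V × V)) := rfl
theorem lie_even (a b : T.TKK) : (⁅a, b⁆.even : Module.End ℂ (V × V)) =
    ⁅(a.even : Module.End ℂ (V × V)), (b.even : Module.End ℂ (V × V))⁆ +
      T.bracketOp a.odd b.odd := rfl
theorem lie_odd (a b : T.TKK) : ⁅a, b⁆.odd = a.even.1 b.odd - b.even.1 a.odd := rfl

instance : LieRing T.TKK where
  add_lie a b c := by
    apply TKK.ext
    · apply Subtype.ext
      simp only [lie_even, add_odd, add_even_coe, add_lie, map_add,
        LinearMap.add_apply]
      abel
    · simp only [lie_odd, add_odd, add_even_coe, map_add, LinearMap.add_apply]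
      abel
  lie_add a b c := by
    apply TKK.ext
    · apply Subtype.ext
      simp only [lie_even, add_odd, add_even_coe, lie_add, map_add]
      abel
    · simp only [lie_odd, add_odd, add_even_coe, map_add, LinearMap.add_apply]
      abel
  lie_self a := by
    apply TKK.ext
    · apply Subtype.ext
      rw [lie_even, lie_self, zero_add, zero_even]
      apply LinearMap.ext
      intro z
      ext <;> simp [bracketOp_apply, kantorTensor_apply]
    · simp [lie_odd]
  leibniz_lie a b c := by
    obtain ⟨⟨A, hA⟩, t⟩ := a
    obtain ⟨⟨B, hB⟩, s⟩ := b
    obtain ⟨⟨C, hC⟩, r⟩ := c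
    apply TKK.ext
    · apply Subtype.ext
      simp only [lie_even, lie_odd, add_even_coe, lie_add, add_lie, map_sub,
        LinearMap.sub_apply, T.lie_bracketOp hA, T.lie_bracketOp hB, leibniz_lie A B C]
      rw [← lie_skew (T.bracketOp t s) C, T.lie_bracketOp hC, T.bracketOp_skew (C t) s,
        T.bracketOp_skew (B t) r]
      abel
    · simp only [lie_even, lie_odd, add_odd, map_sub, LinearMap.add_apply, Ring.lie_def,
        LinearMap.sub_apply, Module.End.mul_apply]
      have h := T.bracketOp_cyclic t s r
      have h' : T.bracketOp r t s = -T.bracketOp t r s := by rw [T.bracketOp_skew r t]; rfl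
      linear_combination (norm := module) h' - h

instance : LieAlgebra ℂ T.TKK where
  lie_smul c a b := by
    apply TKK.ext
    · apply Subtype.ext
      simp only [lie_even, smul_odd, smul_even_coe, map_smul, smul_add]
      simp only [Ring.lie_def, mul_smul_comm, smul_mul_assoc, smul_sub]
    · simp only [lie_odd, smul_odd, smul_even_coe, map_smul, LinearMap.smul_apply, smul_sub]

end TKK

end KantorTripleSystem

/-! ### Type `E₇` -/

/-- A complex Lie algebra is (the simple Lie algebra) of type `E₇`: it is finite-dimensional with
non-degenerate Killing form, and its root system with respect to some Cartan subalgebra has a base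
whose Cartan matrix is, up to a renumbering of the simple roots, the Cartan matrix `E₇`. (Such a
Lie algebra is automatically simple, since the Dynkin diagram `E₇` is connected.) -/
def IsTypeE7 (L : Type*) [LieRing L] [LieAlgebra ℂ L] : Prop :=
  ∃ (_ : FiniteDimensional ℂ L) (_ : LieAlgebra.IsKilling ℂ L)
    (H : LieSubalgebra ℂ L) (_ : H.IsCartanSubalgebra)
    (b : (LieAlgebra.IsKilling.rootSystem H).Base) (e : b.support ≃ Fin 7),
    b.cartanMatrix.reindex e e = CartanMatrix.E₇

/-! ### The forms and polyvectors on `ℂ⁷` -/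

/-- `Λ³(ℂ⁷)*`: alternating trilinear forms on `ℂ⁷`. -/
abbrev ThreeForm : Type := (Fin 7 → ℂ) [⋀^Fin 3]→ₗ[ℂ] ℂ

/-- `Λ³ℂ⁷`: alternating trilinear forms on `(ℂ⁷)*`. -/
abbrev ThreeVector : Type := (Module.Dual ℂ (Fin 7 → ℂ)) [⋀^Fin 3]→ₗ[ℂ] ℂ

/-- The Lie algebra `𝔰𝔩(7, ℂ)`. -/
abbrev SL7 : LieSubalgebra ℂ (Matrix (Fin 7) (Fin 7) ℂ) := LieAlgebra.SpecialLinear.sl (Fin 7) ℂ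

/-- The Lie algebra `𝔰𝔬(7, ℂ)` of skew-symmetric matrices. -/
abbrev SO7 : LieSubalgebra ℂ (Matrix (Fin 7) (Fin 7) ℂ) := LieAlgebra.Orthogonal.so (Fin 7) ℂ

/-- The standard basis vector `e_i` of `ℂ⁷`. -/
def stdVec (i : Fin 7) : Fin 7 → ℂ := Pi.single i 1

/-- The dual basis vector `e^i` of `(ℂ⁷)*`. -/
def stdCovec (i : Fin 7) : Module.Dual ℂ (Fin 7 → ℂ) := LinearMap.proj i

/-- The standard symmetric bilinear form `η` on `ℂ⁷`. -/
def eta (v w : Fin 7 → ℂ) : ℂ := ∑ i, v i * w i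

/-- The musical isomorphism `(ℂ⁷)* → ℂ⁷` of `η`, determined by `η(ξ♯, v) = ξ(v)`. -/
def sharp : Module.Dual ℂ (Fin 7 → ℂ) →ₗ[ℂ] (Fin 7 → ℂ) :=
  LinearMap.pi fun i => LinearMap.applyₗ (stdVec i)

/-- The induced musical isomorphism `Λ³(ℂ⁷)* → Λ³ℂ⁷`,
`β♯(ξ₁, ξ₂, ξ₃) = β(ξ₁♯, ξ₂♯, ξ₃♯)`. -/
def sharp₃ (β : ThreeForm) : ThreeVector := β.compLinearMap sharp

/-- The natural pairing `ι_a β` of a polyvector `a` with a form `β`, normalized by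
`ι_{e_{123}} e^{123} = 1`. -/
def contraction (a : ThreeVector) (β : ThreeForm) : ℂ :=
  (1 / 6) * ∑ i, ∑ j, ∑ k,
    a ![stdCovec i, stdCovec j, stdCovec k] * β ![stdVec i, stdVec j, stdVec k]

/-- The natural extension of `η` to three-forms: `η(α, β) = ι_{β♯} α`. The forms `e^{ijk}`,
`i < j < k`, are an orthonormal basis. -/
def eta₃ (α β : ThreeForm) : ℂ := contraction (sharp₃ β) α

/-- The matrix of the endomorphism `a • β` of `ℂ⁷`, where `•` is the `𝔰𝔩(7)`-equivariant map
`Λ³ℂ⁷ ⊗ Λ³(ℂ⁷)* → 𝔰𝔩(7)` normalized by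
`e_{123} • e^{123} = (4/7) ∑_{i ≤ 3} e_i ⊗ e^i - (3/7) ∑_{j ≥ 4} e_j ⊗ e^j`. It is obtained by
contracting two of the three indices and removing the trace. -/
def bulletMatrix (a : ThreeVector) (β : ThreeForm) : Matrix (Fin 7) (Fin 7) ℂ :=
  Matrix.of (fun i l => (1 / 2) * ∑ j, ∑ k,
    a ![stdCovec i, stdCovec j, stdCovec k] * β ![stdVec l, stdVec j, stdVec k]) -
    ((3 / 7) * contraction a β) • (1 : Matrix (Fin 7) (Fin 7) ℂ)

theorem trace_bulletMatrix (a : ThreeVector) (β : ThreeForm) : (bulletMatrix a β).trace = 0 := by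
  have h : (Matrix.of (fun i l => (1 / 2 : ℂ) * ∑ j, ∑ k,
      a ![stdCovec i, stdCovec j, stdCovec k] *
        β ![stdVec l, stdVec j, stdVec k])).trace = 3 * contraction a β := by
    rw [contraction, Matrix.trace]
    simp only [Matrix.diag_apply, Matrix.of_apply]
    rw [← Finset.mul_sum]
    ring
  rw [bulletMatrix, Matrix.trace_sub, h, Matrix.trace_smul, Matrix.trace_one]
  simp only [Fintype.card_fin, smul_eq_mul]
  push_cast
  ring

/-- The map `• : Λ³ℂ⁷ × Λ³(ℂ⁷)* → 𝔰𝔩(7)`. -/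
def bullet (a : ThreeVector) (β : ThreeForm) : SL7 := ⟨bulletMatrix a β, trace_bulletMatrix a β⟩

/-- The natural action of a matrix `A` on three-forms:
`(A · γ)(v₁, v₂, v₃) = -γ(Av₁, v₂, v₃) - γ(v₁, Av₂, v₃) - γ(v₁, v₂, Av₃)`. -/
def formAction (A : Matrix (Fin 7) (Fin 7) ℂ) (γ : ThreeForm) : ThreeForm where
  __ := -∑ i : Fin 3, γ.toMultilinearMap.compLinearMap
    (Function.update (fun _ => LinearMap.id) i (Matrix.toLin' A))
  map_eq_zero_of_eq' v i j hv hij := by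
    change (-∑ i : Fin 3, γ.toMultilinearMap.compLinearMap
      (Function.update (fun _ => LinearMap.id) i (Matrix.toLin' A))) v = 0
    have key : ∀ m : Fin 3, (γ.toMultilinearMap.compLinearMap
        (Function.update (fun _ => LinearMap.id) m (Matrix.toLin' A))) v =
        γ (Function.update v m (A *ᵥ v m)) := by
      intro m
      rw [MultilinearMap.compLinearMap_apply]
      change γ _ = γ _
      congr 1
      ext k : 1
      rcases eq_or_ne k m with rfl | hk
      · simp
      · simp [hk]
    rw [_root_.neg_apply, _root_.sum_apply, neg_eq_zero,
      Finset.sum_congr rfl fun m _ => key m, Fintype.sum_eq_add i j hij]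
    · have : Function.update v j (A *ᵥ v j) =
          Function.update v i (A *ᵥ v i) ∘ Equiv.swap i j := by
        ext k : 1
        simp only [Function.comp_apply]
        rcases eq_or_ne k i with rfl | hki
        · simp [hij, hij.symm, hv]
        · rcases eq_or_ne k j with rfl | hkj
          · simp [hv]
          · rw [Equiv.swap_apply_of_ne_of_ne hki hkj]
            simp [hki, hkj]
      rw [this, γ.map_swap _ hij, add_neg_cancel]
    · rintro m ⟨hi, hj⟩
      apply γ.map_eq_zero_of_eq _ _ hij
      simp [hi.symm, hj.symm, hv]

theorem formAction_apply (A : Matrix (Fin 7) (Fin 7) ℂ) (γ : ThreeForm) (v₁ v₂ v₃ : Fin 7 → ℂ) :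
    formAction A γ ![v₁, v₂, v₃] =
      -γ ![A *ᵥ v₁, v₂, v₃] - γ ![v₁, A *ᵥ v₂, v₃] - γ ![v₁, v₂, A *ᵥ v₃] := by
  change (-∑ i : Fin 3, γ.toMultilinearMap.compLinearMap
      (Function.update (fun _ => LinearMap.id) i (Matrix.toLin' A))) ![v₁, v₂, v₃] = _
  rw [_root_.neg_apply, _root_.sum_apply, Fin.sum_univ_three]
  simp only [MultilinearMap.compLinearMap_apply]
  have h0 : (fun k => (Function.update (fun _ => LinearMap.id) (0 : Fin 3) (Matrix.toLin' A) :
      Fin 3 → ((Fin 7 → ℂ) →ₗ[ℂ] (Fin 7 → ℂ))) k (![v₁, v₂, v₃] k)) = ![A *ᵥ v₁, v₂, v₃] := by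
    ext k : 1; fin_cases k <;> simp
  have h1 : (fun k => (Function.update (fun _ => LinearMap.id) (1 : Fin 3) (Matrix.toLin' A) :
      Fin 3 → ((Fin 7 → ℂ) →ₗ[ℂ] (Fin 7 → ℂ))) k (![v₁, v₂, v₃] k)) = ![v₁, A *ᵥ v₂, v₃] := by
    ext k : 1; fin_cases k <;> simp
  have h2 : (fun k => (Function.update (fun _ => LinearMap.id) (2 : Fin 3) (Matrix.toLin' A) :
      Fin 3 → ((Fin 7 → ℂ) →ₗ[ℂ] (Fin 7 → ℂ))) k (![v₁, v₂, v₃] k)) = ![v₁, v₂, A *ᵥ v₃] := by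
    ext k : 1; fin_cases k <;> simp
  rw [h0, h1, h2]
  change -(γ _ + γ _ + γ _) = _
  ring

/-- The stabilizer of `η` in `𝔰𝔩(7, ℂ)`. -/
def stabEta : LieSubalgebra ℂ SL7 where
  carrier := {A | ∀ v w, eta (A.1 *ᵥ v) w + eta v (A.1 *ᵥ w) = 0}
  add_mem' {A B} hA hB v w := by
    have h1 : eta (A.1 *ᵥ v) w + eta v (A.1 *ᵥ w) = 0 := hA v w
    have h2 : eta (B.1 *ᵥ v) w + eta v (B.1 *ᵥ w) = 0 := hB v w
    change eta ((A.1 + B.1) *ᵥ v) w + eta v ((A.1 + B.1) *ᵥ w) = 0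
    simp only [eta, Matrix.add_mulVec, Pi.add_apply, add_mul, mul_add,
      Finset.sum_add_distrib] at h1 h2 ⊢
    linear_combination h1 + h2
  zero_mem' v w := by
    change eta ((0 : Matrix (Fin 7) (Fin 7) ℂ) *ᵥ v) w +
      eta v ((0 : Matrix (Fin 7) (Fin 7) ℂ) *ᵥ w) = 0
    simp [eta]
  smul_mem' c A hA v w := by
    have h1 : eta (A.1 *ᵥ v) w + eta v (A.1 *ᵥ w) = 0 := hA v w
    change eta ((c • A.1) *ᵥ v) w + eta v ((c • A.1) *ᵥ w) = 0
    simp only [eta, Matrix.smul_mulVec, Pi.smul_apply, smul_eq_mul, mul_assoc, mul_left_comm _ c,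
      ← Finset.mul_sum] at h1 ⊢
    linear_combination c * h1
  lie_mem' {A B} hA hB v w := by
    have h1 : ∀ v w, eta (A.1 *ᵥ v) w + eta v (A.1 *ᵥ w) = 0 := hA
    have h2 : ∀ v w, eta (B.1 *ᵥ v) w + eta v (B.1 *ᵥ w) = 0 := hB
    change eta ((A.1 * B.1 - B.1 * A.1) *ᵥ v) w + eta v ((A.1 * B.1 - B.1 * A.1) *ᵥ w) = 0
    have e1 : ∀ x y z : Fin 7 → ℂ, eta (x - y) z = eta x z - eta y z := by
      intro x y z; simp [eta, sub_mul, Finset.sum_sub_distrib]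
    have e2 : ∀ x y z : Fin 7 → ℂ, eta z (x - y) = eta z x - eta z y := by
      intro x y z; simp [eta, mul_sub, Finset.sum_sub_distrib]
    simp only [Matrix.sub_mulVec, ← Matrix.mulVec_mulVec, e1, e2]
    linear_combination h1 (B.1 *ᵥ v) w - h2 (A.1 *ᵥ v) w + h1 v (B.1 *ᵥ w) - h2 v (A.1 *ᵥ w)

end

/-! Everything rests on one equivariant map. Contracting two of the three indices of `β` with those
of `α` gives a matrix `C(α, β)`, and for `M = (1/9) tr C · 1 - C` the product is `(αβγ) = M(α, β) ·
γ`, where `M(α, β)` acts through the representation `ρ` of `𝔤𝔩(7)`. Two properties of `M` are used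
throughout: `M(β, α) = M(α, β)ᵀ`, and `M(A·α, β) - M(α, Aᵀ·β) = [A, M(α, β)]`. Together they say
that `ρ(A)` is compatible with the product up to a transpose in the middle slot (`rho_formTriple`);
identity (i) is the case `A = M(u, v)`.

For identity (ii), the Kantor tensor turns out to be an exterior product: `K_{uv}(e^{abc})` is minus
the contraction of `ω = u ∧ v` with `e_{abc}` (`kantorTensor_basisForm`). As `M(y, e^{abc})` acts on
`u ∧ v` by the Leibniz rule, (ii) becomes `(ι_{abc} ω) ∧ y + M(y, e^{abc}) · ω = 0` for six-forms
`ω` (`wedge₃_contract`). A six-form in dimension seven has only seven components, and each is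
checked directly.

The matrices `M(α, β)` span `𝔤𝔩(7)`, which acts irreducibly on three-forms; this gives
`K`-simplicity. It also puts the scalar matrices, hence the grading element, into `𝔤₀`. Every ideal
is then stable under separation of degrees `-1` and `1`, so an abelian ideal would produce a
`K`-ideal and must vanish: the radical of `𝔤` is zero. Type `E₇` is read off from Chevalley
generators: the matrix units next to the diagonal give the chain `A₆`, and `e^{012}` in degree `-1`
gives the branch node.

A derivation `δ` extends to `𝔤` by preserving degrees and commuting with `σ`. Derivations of `𝔤` are
inner, so `diag(δ, δ)` lies in the even part, whose diagonal blocks are `ρ(A)` and `-ρ(Aᵀ)`.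
Injectivity of `ρ` yields `Aᵀ = -A`. -/

noncomputable section

/-! ### Components of three-forms -/

namespace ThreeForm

theorem swap₁₂ (α : ThreeForm) (u v w : Fin 7 → ℂ) : α ![u, v, w] = -α ![v, u, w] := by
  have h : ![u, v, w] = ![v, u, w] ∘ Equiv.swap (0 : Fin 3) 1 := by
    ext k : 1; fin_cases k <;> simp [Equiv.swap_apply_of_ne_of_ne]
  rw [h, α.map_swap _ (by decide)]

theorem swap₂₃ (α : ThreeForm) (u v w : Fin 7 → ℂ) : α ![u, v, w] = -α ![u, w, v] := by
  have h : ![u, v, w] = ![u, w, v] ∘ Equiv.swap (1 : Fin 3) 2 := by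
    ext k : 1; fin_cases k <;> simp [Equiv.swap_apply_of_ne_of_ne]
  rw [h, α.map_swap _ (by decide)]

theorem cycle (α : ThreeForm) (u v w : Fin 7 → ℂ) : α ![u, v, w] = α ![v, w, u] := by
  rw [swap₁₂, swap₂₃, neg_neg]

/-- A three-form as a linear function of its first argument. -/
def firstArg (α : ThreeForm) (v w : Fin 7 → ℂ) : (Fin 7 → ℂ) →ₗ[ℂ] ℂ where
  toFun u := α ![u, v, w]
  map_add' := α.map_vecCons_add ![v, w]
  map_smul' := α.map_vecCons_smul ![v, w]

/-- The components `α_{abc}` of a three-form. -/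
def coord (α : ThreeForm) (a b c : Fin 7) : ℂ := α ![stdVec a, stdVec b, stdVec c]

theorem ext_coord {α β : ThreeForm} (h : ∀ a b c, coord α a b c = coord β a b c) : α = β := by
  refine Module.Basis.ext_alternating (Pi.basisFun ℂ (Fin 7)) fun v _ => ?_
  have hv : (fun i => (Pi.basisFun ℂ (Fin 7)) (v i)) =
      ![stdVec (v 0), stdVec (v 1), stdVec (v 2)] := by
    ext k : 1; fin_cases k <;> simp [stdVec]
  rw [hv]; exact h _ _ _

@[simp] theorem coord_add (α β : ThreeForm) (a b c : Fin 7) :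
    coord (α + β) a b c = coord α a b c + coord β a b c := rfl
@[simp] theorem coord_sub (α β : ThreeForm) (a b c : Fin 7) :
    coord (α - β) a b c = coord α a b c - coord β a b c := rfl
@[simp] theorem coord_neg (α : ThreeForm) (a b c : Fin 7) :
    coord (-α) a b c = -coord α a b c := rfl
@[simp] theorem coord_smul (t : ℂ) (α : ThreeForm) (a b c : Fin 7) :
    coord (t • α) a b c = t * coord α a b c := rfl
@[simp] theorem coord_zero (a b c : Fin 7) : coord 0 a b c = 0 := rfl

theorem coord_swap₁₂ (α : ThreeForm) (a b c : Fin 7) : coord α a b c = -coord α b a c :=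
  swap₁₂ _ _ _ _
theorem coord_swap₂₃ (α : ThreeForm) (a b c : Fin 7) : coord α a b c = -coord α a c b :=
  swap₂₃ _ _ _ _
theorem coord_cycle (α : ThreeForm) (a b c : Fin 7) : coord α a b c = coord α b c a :=
  cycle _ _ _ _
@[simp] theorem coord_self₁₂ (α : ThreeForm) (a b : Fin 7) : coord α a a b = 0 :=
  self_eq_neg.mp (coord_swap₁₂ α a a b)
@[simp] theorem coord_self₂₃ (α : ThreeForm) (a b : Fin 7) : coord α a b b = 0 :=
  self_eq_neg.mp (coord_swap₂₃ α a b b)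
@[simp] theorem coord_self₁₃ (α : ThreeForm) (a b : Fin 7) : coord α a b a = 0 := by
  rw [coord_cycle, coord_self₂₃]

theorem mulVec_stdVec (A : Matrix (Fin 7) (Fin 7) ℂ) (a : Fin 7) :
    A *ᵥ stdVec a = ∑ n, A n a • stdVec n := by
  ext i
  simp [stdVec, Pi.single_apply]

theorem apply_mulVec_stdVec (α : ThreeForm) (A : Matrix (Fin 7) (Fin 7) ℂ) (a : Fin 7)
    (v w : Fin 7 → ℂ) : α ![A *ᵥ stdVec a, v, w] = ∑ n, A n a * α ![stdVec n, v, w] := by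
  change α.firstArg v w _ = _
  rw [mulVec_stdVec, map_sum]
  exact Finset.sum_congr rfl fun n _ => by rw [map_smul]; rfl

theorem coord_formAction (A : Matrix (Fin 7) (Fin 7) ℂ) (α : ThreeForm) (a b c : Fin 7) :
    coord (formAction A α) a b c = -∑ n, A n a * coord α n b c - ∑ n, A n b * coord α a n c
      - ∑ n, A n c * coord α a b n := by
  rw [coord, formAction_apply, apply_mulVec_stdVec, swap₁₂ α (stdVec a), apply_mulVec_stdVec,
    ← cycle α (A *ᵥ stdVec c), apply_mulVec_stdVec]
  simp only [← Finset.sum_neg_distrib]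
  congr 1
  · congr 1
    refine Finset.sum_congr rfl fun n _ => ?_
    rw [swap₁₂ α]; simp [coord]
  · refine Finset.sum_congr rfl fun n _ => ?_
    rw [cycle α]; rfl

end ThreeForm

open ThreeForm

/-! ### The action of `𝔤𝔩(7)` and the equivariant contraction -/

/-- The action `ρ` of `𝔤𝔩(7)` on three-forms, as a linear map. -/
def rho : Matrix (Fin 7) (Fin 7) ℂ →ₗ[ℂ] Module.End ℂ ThreeForm :=
  LinearMap.mk₂ ℂ formAction
    (fun A B α => ext_coord fun a b c => by
      simp only [coord_formAction, coord_add, Matrix.add_apply, add_mul, Finset.sum_add_distrib]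
      ring)
    (fun t A α => ext_coord fun a b c => by
      simp only [coord_formAction, coord_smul, Matrix.smul_apply, smul_eq_mul, mul_assoc,
        ← Finset.mul_sum]
      ring)
    (fun A α β => ext_coord fun a b c => by
      simp only [coord_formAction, coord_add, mul_add, Finset.sum_add_distrib]
      ring)
    (fun t A α => ext_coord fun a b c => by
      simp only [coord_formAction, coord_smul, mul_left_comm _ t, ← Finset.mul_sum]
      ring)

theorem rho_apply (A : Matrix (Fin 7) (Fin 7) ℂ) (α : ThreeForm) : rho A α = formAction A α := rfl

theorem coord_rho (A : Matrix (Fin 7) (Fin 7) ℂ) (α : ThreeForm) (a b c : Fin 7) :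
    coord (rho A α) a b c = -∑ n, A n a * coord α n b c - ∑ n, A n b * coord α a n c
      - ∑ n, A n c * coord α a b n := coord_formAction A α a b c

theorem rho_one : rho 1 = (-3 : ℂ) • (1 : Module.End ℂ ThreeForm) := by
  refine LinearMap.ext fun α => ext_coord fun a b c => ?_
  rw [coord_rho]
  simp [Matrix.one_apply]
  ring

theorem rho_lie (A B : Matrix (Fin 7) (Fin 7) ℂ) : rho (A * B - B * A) = ⁅rho A, rho B⁆ := by
  refine LinearMap.ext fun α => ext_coord fun a b c => ?_
  have h : ∀ (v w x y : Fin 7 → ℂ), α ![x - y, v, w] = α ![x, v, w] - α ![y, v, w] :=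
    fun v w x y => (α.firstArg v w).map_sub x y
  rw [coord, rho_apply, formAction_apply, Ring.lie_def, LinearMap.sub_apply, Module.End.mul_apply,
    Module.End.mul_apply, coord_sub, coord, coord]
  simp only [rho_apply, formAction_apply, Matrix.sub_mulVec, ← Matrix.mulVec_mulVec]
  -- Each commutator argument is moved to the first slot, where linearity is available. The terms
  -- with `A` and `B` in different slots cancel.
  rw [h, swap₁₂ α (stdVec a) (_ - _), h, ← cycle α (_ - _), h, swap₁₂ α (A *ᵥ B *ᵥ stdVec b),
    swap₁₂ α (B *ᵥ A *ᵥ stdVec b), cycle α (A *ᵥ B *ᵥ stdVec c), cycle α (B *ᵥ A *ᵥ stdVec c)]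
  ring

/-- The contraction of two of the three indices of a pair of three-forms. -/
def contract₂ : ThreeForm →ₗ[ℂ] ThreeForm →ₗ[ℂ] Matrix (Fin 7) (Fin 7) ℂ :=
  LinearMap.mk₂ ℂ
    (fun α β => Matrix.of fun i l => (1 / 2) * ∑ j, ∑ k, coord β i j k * coord α l j k)
    (fun α α' β => by
      ext i l; simp [mul_add, Finset.sum_add_distrib])
    (fun t α β => by
      ext i l; simp [mul_left_comm _ t, ← Finset.mul_sum])
    (fun α β β' => by
      ext i l; simp [add_mul, mul_add, Finset.sum_add_distrib])
    (fun t α β => by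
      ext i l; simp [mul_left_comm _ t, mul_assoc, ← Finset.mul_sum])

theorem contract₂_apply (α β : ThreeForm) (i l : Fin 7) :
    contract₂ α β i l = (1 / 2) * ∑ j, ∑ k, coord β i j k * coord α l j k := rfl

theorem contract₂_swap (α β : ThreeForm) : contract₂ β α = (contract₂ α β)ᵀ := by
  ext i l
  simp only [contract₂_apply, Matrix.transpose_apply, mul_comm (coord α _ _ _)]

/-- Infinitesimal invariance of the contraction. The terms where `A` hits one of the two summed
indices cancel between `α` and `β`, by relabelling sums (`e₁`, `e₂`); only the terms on the free
indices survive, and they form the commutator. -/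
theorem contract₂_rho (A : Matrix (Fin 7) (Fin 7) ℂ) (α β : ThreeForm) :
    contract₂ (rho A α) β - contract₂ α (rho Aᵀ β) = A * contract₂ α β - contract₂ α β * A := by
  ext i l
  simp only [Matrix.sub_apply, Matrix.mul_apply, contract₂_apply, coord_rho, Matrix.transpose_apply,
    mul_sub, sub_mul, Finset.sum_sub_distrib, neg_mul, mul_neg, Finset.sum_neg_distrib,
    Finset.mul_sum, Finset.sum_mul]
  have e₁ : ∑ x, ∑ x₁, ∑ x₂, 1 / 2 * (coord β i x x₁ * (A x₂ x * coord α l x₂ x₁)) =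
      ∑ x, ∑ x₁, ∑ x₂, 1 / 2 * (A x x₂ * coord β i x₂ x₁ * coord α l x x₁) := by
    rw [Finset.sum_congr rfl fun x _ => Finset.sum_comm, Finset.sum_comm]
    refine Finset.sum_congr rfl fun x _ => ?_
    rw [Finset.sum_comm]
    refine Finset.sum_congr rfl fun y _ => Finset.sum_congr rfl fun z _ => ?_
    ring
  have e₂ : ∑ x, ∑ x₁, ∑ x₂, 1 / 2 * (coord β i x x₁ * (A x₂ x₁ * coord α l x x₂)) =
      ∑ x, ∑ x₁, ∑ x₂, 1 / 2 * (A x₁ x₂ * coord β i x x₂ * coord α l x x₁) := by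
    refine Finset.sum_congr rfl fun x _ => ?_
    rw [Finset.sum_comm]
    refine Finset.sum_congr rfl fun y _ => Finset.sum_congr rfl fun z _ => ?_
    ring
  have e₃ : ∑ x, ∑ x₁, ∑ x₂, 1 / 2 * (coord β i x x₁ * (A x₂ l * coord α x₂ x x₁)) =
      ∑ x, ∑ x₁, ∑ x₂, 1 / 2 * (coord β i x₁ x₂ * coord α x x₁ x₂) * A x l := by
    rw [Finset.sum_congr rfl fun x _ => Finset.sum_comm, Finset.sum_comm]
    refine Finset.sum_congr rfl fun x _ => Finset.sum_congr rfl fun y _ =>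
      Finset.sum_congr rfl fun z _ => ?_
    ring
  have e₄ : ∑ x, ∑ x₁, ∑ x₂, 1 / 2 * (A i x₂ * coord β x₂ x x₁ * coord α l x x₁) =
      ∑ x, ∑ x₁, ∑ x₂, A i x * (1 / 2 * (coord β x x₁ x₂ * coord α l x₁ x₂)) := by
    rw [Finset.sum_congr rfl fun x _ => Finset.sum_comm, Finset.sum_comm]
    refine Finset.sum_congr rfl fun x _ => Finset.sum_congr rfl fun y _ =>
      Finset.sum_congr rfl fun z _ => ?_
    ring
  rw [e₁, e₂, e₃, e₄]
  ring

theorem sharp_stdCovec (i : Fin 7) : sharp (stdCovec i) = stdVec i := by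
  ext j
  simp [sharp, stdCovec, stdVec, Pi.single_apply, eq_comm]

theorem sharp₃_stdCovec (β : ThreeForm) (i j k : Fin 7) :
    sharp₃ β ![stdCovec i, stdCovec j, stdCovec k] = coord β i j k := by
  rw [sharp₃, AlternatingMap.compLinearMap_apply, coord]
  congr 1
  ext m : 1
  fin_cases m <;> simp [sharp_stdCovec]

theorem eta₃_eq_trace (α β : ThreeForm) : eta₃ α β = (1 / 3) * (contract₂ α β).trace := by
  simp only [eta₃, contraction, sharp₃_stdCovec, Matrix.trace, Matrix.diag_apply, contract₂_apply]
  rw [← Finset.mul_sum]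
  simp only [coord]
  ring

theorem bulletMatrix_sharp₃ (α β : ThreeForm) :
    bulletMatrix (sharp₃ β) α = contract₂ α β - ((3 / 7) * eta₃ α β) • 1 := by
  ext i l
  simp only [bulletMatrix, sharp₃_stdCovec]
  rfl

/-! ### The triple product and identity (i) -/

/-- The matrix `M(α, β)` with `(αβγ) = M(α, β) · γ`. -/
def tripleMatrix : ThreeForm →ₗ[ℂ] ThreeForm →ₗ[ℂ] Matrix (Fin 7) (Fin 7) ℂ :=
  contract₂.compr₂ ((1 / 9 : ℂ) • (Matrix.traceLinearMap (Fin 7) ℂ ℂ).smulRight 1 - LinearMap.id)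

theorem tripleMatrix_apply (α β : ThreeForm) :
    tripleMatrix α β = ((1 / 9 : ℂ) * (contract₂ α β).trace) • 1 - contract₂ α β := by
  simp [tripleMatrix, mul_smul]

theorem tripleMatrix_swap (α β : ThreeForm) : tripleMatrix β α = (tripleMatrix α β)ᵀ := by
  simp [tripleMatrix_apply, contract₂_swap α β]

/-- The trace correction does not disturb equivariance: a commutator has trace zero, so the two
scalar terms agree. -/
theorem tripleMatrix_rho (A : Matrix (Fin 7) (Fin 7) ℂ) (α β : ThreeForm) :
    tripleMatrix (rho A α) β - tripleMatrix α (rho Aᵀ β) =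
      A * tripleMatrix α β - tripleMatrix α β * A := by
  have h := contract₂_rho A α β
  have ht : (contract₂ (rho A α) β).trace = (contract₂ α (rho Aᵀ β)).trace := by
    rw [← sub_eq_zero, ← Matrix.trace_sub, h, Matrix.trace_sub, Matrix.trace_mul_comm, sub_self]
  simp only [tripleMatrix_apply, ht]
  rw [sub_sub_sub_cancel_left, ← neg_sub, h]
  simp [mul_sub, sub_mul]

/-- The triple product on three-forms. -/
def formTriple : ThreeForm →ₗ[ℂ] ThreeForm →ₗ[ℂ] ThreeForm →ₗ[ℂ] ThreeForm :=
  tripleMatrix.compr₂ rho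

theorem formTriple_eq_rho (α β : ThreeForm) : formTriple α β = rho (tripleMatrix α β) := rfl

/-- Since `tr C = 3η(α, β)`, passing from `C` to `β♯ • α` leaves the scalar `1/3 - 3/7 = -2/21` in
`M`. The identity matrix acts on three-forms by `-3`, which turns it into `2/7`. -/
theorem formTriple_apply (α β γ : ThreeForm) :
    formTriple α β γ = ((2 / 7 : ℂ) * eta₃ α β) • γ - formAction (bullet (sharp₃ β) α).1 γ := by
  have h : tripleMatrix α β =
      (-(2 / 21) * eta₃ α β) • 1 - bulletMatrix (sharp₃ β) α := by
    rw [tripleMatrix_apply, bulletMatrix_sharp₃, eta₃_eq_trace]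
    module
  rw [formTriple_eq_rho, h, map_sub, map_smul, rho_one]
  change ((-(2 / 21) * eta₃ α β) • (-3 : ℂ) • γ) - formAction (bulletMatrix (sharp₃ β) α) γ = _
  rw [smul_smul]
  congr 2
  ring

theorem rho_formTriple (A : Matrix (Fin 7) (Fin 7) ℂ) (x y z : ThreeForm) :
    rho A (formTriple x y z) =
      formTriple (rho A x) y z - formTriple x (rho Aᵀ y) z + formTriple x y (rho A z) := by
  have h := congrArg (fun B => rho B z) (tripleMatrix_rho A x y)
  simp only [rho_lie] at h
  simp only [map_sub, Ring.lie_def, LinearMap.sub_apply, Module.End.mul_apply] at h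
  simp only [formTriple_eq_rho]
  rw [h, sub_add_cancel]

/-- The case `A = M(u, v)` of `rho_formTriple`: the transpose in the middle slot exchanges `u` and
`v`. -/
theorem formTriple_formTriple (u v x y z : ThreeForm) :
    formTriple u v (formTriple x y z) =
      formTriple (formTriple u v x) y z - formTriple x (formTriple v u y) z
        + formTriple x y (formTriple u v z) := by
  rw [formTriple_eq_rho u v, rho_formTriple, ← tripleMatrix_swap, ← formTriple_eq_rho v u]

/-! ### Basis forms and the product in components -/

/-- The Kronecker delta. -/
def kron (a b : Fin 7) : ℂ := if a = b then 1 else 0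

theorem kron_self (a : Fin 7) : kron a a = 1 := if_pos rfl

theorem kron_of_ne {a b : Fin 7} (h : a ≠ b) : kron a b = 0 := if_neg h

theorem kron_comm (a b : Fin 7) : kron a b = kron b a := by simp [kron, eq_comm]

theorem sum_kron (a : Fin 7) (f : Fin 7 → ℂ) : ∑ x, kron x a * f x = f a := by
  simp [kron]

theorem sum_kron₂ (a b : Fin 7) (f : Fin 7 → Fin 7 → ℂ) :
    ∑ x, ∑ y, kron x a * kron y b * f x y = f a b := by
  simp only [mul_assoc, ← Finset.mul_sum, sum_kron]

theorem sum_kron₃ (a b c : Fin 7) (f : Fin 7 → Fin 7 → Fin 7 → ℂ) :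
    ∑ x, ∑ y, ∑ z, kron x a * kron y b * kron z c * f x y z = f a b c := by
  simp only [mul_assoc, ← Finset.mul_sum, sum_kron]

/-- The form `e^{abc} = e^a ∧ e^b ∧ e^c`. -/
def basisForm (a b c : Fin 7) : ThreeForm :=
  Matrix.detRowAlternating.compLinearMap (LinearMap.funLeft ℂ ℂ ![a, b, c])

theorem coord_basisForm (a b c i j k : Fin 7) : coord (basisForm a b c) i j k =
    kron i a * kron j b * kron k c - kron i a * kron j c * kron k b
      + kron i b * kron j c * kron k a - kron i b * kron j a * kron k c
      + kron i c * kron j a * kron k b - kron i c * kron j b * kron k a := by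
  have hk : ∀ x y, (stdVec x : Fin 7 → ℂ) y = kron x y := fun x y => by
    simp [stdVec, kron, Pi.single_apply, eq_comm]
  have h : coord (basisForm a b c) i j k = Matrix.det (Matrix.of fun m n : Fin 3 =>
      (stdVec (![i, j, k] m) (![a, b, c] n) : ℂ)) := by
    change Matrix.det (R := ℂ) (fun m =>
      LinearMap.funLeft ℂ ℂ ![a, b, c] (![stdVec i, stdVec j, stdVec k] m)) = _
    congr 1
    ext m n
    fin_cases m <;> rfl
  rw [h, Matrix.det_fin_three]
  simp only [Matrix.of_apply, hk, Matrix.cons_val]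
  ring

theorem contract₂_basisForm (α : ThreeForm) (a b c n p : Fin 7) :
    contract₂ α (basisForm a b c) n p =
      kron n a * coord α p b c + kron n b * coord α p c a + kron n c * coord α p a b := by
  have h : ∀ j k, coord (basisForm a b c) n j k * coord α p j k =
      kron n a * (kron j b * kron k c * coord α p j k)
      - kron n a * (kron j c * kron k b * coord α p j k)
      + kron n b * (kron j c * kron k a * coord α p j k)
      - kron n b * (kron j a * kron k c * coord α p j k)
      + kron n c * (kron j a * kron k b * coord α p j k)
      - kron n c * (kron j b * kron k a * coord α p j k) := fun j k => by
    rw [coord_basisForm]; ring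
  rw [contract₂_apply]
  simp only [h, Finset.sum_add_distrib, Finset.sum_sub_distrib, ← Finset.mul_sum, sum_kron₂]
  rw [coord_swap₂₃ α p c b, coord_swap₂₃ α p a c, coord_swap₂₃ α p b a]
  ring

theorem trace_contract₂_basisForm (α : ThreeForm) (a b c : Fin 7) :
    (contract₂ α (basisForm a b c)).trace = 3 * coord α a b c := by
  simp only [Matrix.trace, Matrix.diag_apply, contract₂_basisForm, Finset.sum_add_distrib,
    sum_kron]
  rw [← coord_cycle α a b c, coord_cycle α c a b]
  ring

theorem tripleMatrix_basisForm (α : ThreeForm) (a b c n p : Fin 7) :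
    tripleMatrix α (basisForm a b c) n p = (1 / 3) * coord α a b c * kron n p
      - (kron n a * coord α p b c + kron n b * coord α p c a + kron n c * coord α p a b) := by
  rw [tripleMatrix_apply, trace_contract₂_basisForm, Matrix.sub_apply, contract₂_basisForm,
    Matrix.smul_apply, Matrix.one_apply, smul_eq_mul]
  change 1 / 9 * (3 * coord α a b c) * kron n p - _ = _
  ring

/-- The product `(α e^{abc} γ)` in components. -/
theorem coord_formTriple_basisForm (α γ : ThreeForm) (a b c p q r : Fin 7) :
    coord (formTriple α (basisForm a b c) γ) p q r = -coord α a b c * coord γ p q r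
      + (coord α p b c * coord γ a q r + coord α p c a * coord γ b q r
        + coord α p a b * coord γ c q r)
      + (coord α q b c * coord γ p a r + coord α q c a * coord γ p b r
        + coord α q a b * coord γ p c r)
      + (coord α r b c * coord γ p q a + coord α r c a * coord γ p q b
        + coord α r a b * coord γ p q c) := by
  have h : ∀ (m : Fin 7) (f : Fin 7 → ℂ), ∑ n, tripleMatrix α (basisForm a b c) n m * f n =
      (1 / 3) * coord α a b c * f m
        - (coord α m b c * f a + coord α m c a * f b + coord α m a b * f c) := fun m f => by
    have h' : ∀ n, tripleMatrix α (basisForm a b c) n m * f n =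
        kron n m * ((1 / 3) * coord α a b c * f n) - (kron n a * (coord α m b c * f n)
          + kron n b * (coord α m c a * f n) + kron n c * (coord α m a b * f n)) := fun n => by
      rw [tripleMatrix_basisForm]; ring
    simp only [h', Finset.sum_sub_distrib, Finset.sum_add_distrib, sum_kron]
  rw [formTriple_eq_rho, coord_rho, h p fun n => coord γ n q r, h q fun n => coord γ p n r,
    h r fun n => coord γ p q n]
  ring

/-- The factor `1/6` compensates for summing over all ordered triples instead of `a < b < c`. -/
theorem eq_sum_basisForm (α : ThreeForm) :
    α = ∑ a, ∑ b, ∑ c, ((1 / 6) * coord α a b c) • basisForm a b c := by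
  refine ext_coord fun i j k => ?_
  have hs : ∀ (s : Finset (Fin 7)) (f : Fin 7 → ThreeForm),
      coord (∑ x ∈ s, f x) i j k = ∑ x ∈ s, coord (f x) i j k := by
    intro s f
    induction s using Finset.cons_induction with
    | empty => simp
    | cons x s hx ih => rw [Finset.sum_cons, coord_add, ih, Finset.sum_cons]
  have h : ∀ a b c, coord (((1 / 6) * coord α a b c) • basisForm a b c) i j k = (1 / 6) *
      (kron a i * kron b j * kron c k * coord α a b c
      - kron a i * kron b k * kron c j * coord α a b c
      + kron a k * kron b i * kron c j * coord α a b c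
      - kron a j * kron b i * kron c k * coord α a b c
      + kron a j * kron b k * kron c i * coord α a b c
      - kron a k * kron b j * kron c i * coord α a b c) := fun a b c => by
    rw [coord_smul, coord_basisForm]
    simp only [kron_comm i, kron_comm j, kron_comm k]
    ring
  simp only [hs, h, ← Finset.mul_sum, Finset.sum_add_distrib, Finset.sum_sub_distrib, sum_kron₃]
  rw [← coord_cycle α i j k, coord_cycle α k i j, coord_swap₂₃ α i k j, coord_swap₁₂ α k j i,
    ← coord_cycle α i j k, coord_swap₁₂ α j i k]
  ring

theorem basisForm_eq_zero {a b c : Fin 7} (h : a = b ∨ a = c ∨ b = c) : basisForm a b c = 0 := by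
  refine ext_coord fun i j k => ?_
  rw [coord_basisForm, coord_zero]
  rcases h with rfl | rfl | rfl <;> ring

theorem basisForm_cycle (a b c : Fin 7) : basisForm a b c = basisForm b c a := by
  refine ext_coord fun i j k => ?_
  rw [coord_basisForm, coord_basisForm]
  ring

theorem basisForm_swap (a b c : Fin 7) : basisForm a b c = -basisForm b a c := by
  refine ext_coord fun i j k => ?_
  rw [coord_neg, coord_basisForm, coord_basisForm]
  ring

/-- Distinctness of the indices costs nothing, as other basis forms vanish, and it is needed to
bring `a, b, c` to standard position by a permutation in `wedge₃_contract`. -/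
theorem threeForm_linearMap_ext {M : Type*} [AddCommGroup M] [Module ℂ M]
    {f g : ThreeForm →ₗ[ℂ] M}
    (h : ∀ a b c, a ≠ b → a ≠ c → b ≠ c → f (basisForm a b c) = g (basisForm a b c)) :
    f = g := by
  refine LinearMap.ext fun α => ?_
  rw [eq_sum_basisForm α]
  simp only [map_sum, map_smul]
  refine Finset.sum_congr rfl fun a _ => Finset.sum_congr rfl fun b _ =>
    Finset.sum_congr rfl fun c _ => ?_
  by_cases hd : a = b ∨ a = c ∨ b = c
  · simp [basisForm_eq_zero hd]
  · push Not at hd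
    rw [h a b c hd.1 hd.2.1 hd.2.2]

/-! ### Six-forms in dimension seven and identity (ii) -/

/-- A tensor with three indices is totally antisymmetric. -/
structure IsAlt₃ (f : Fin 7 → Fin 7 → Fin 7 → ℂ) : Prop where
  swap₁₂ : ∀ a b c, f a b c = -f b a c
  swap₂₃ : ∀ a b c, f a b c = -f a c b

theorem IsAlt₃.self₁₂ {f : Fin 7 → Fin 7 → Fin 7 → ℂ} (h : IsAlt₃ f) (a b : Fin 7) :
    f a a b = 0 := self_eq_neg.mp (h.swap₁₂ a a b)

theorem IsAlt₃.self₂₃ {f : Fin 7 → Fin 7 → Fin 7 → ℂ} (h : IsAlt₃ f) (a b : Fin 7) :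
    f a b b = 0 := self_eq_neg.mp (h.swap₂₃ a b b)

theorem IsAlt₃.self₁₃ {f : Fin 7 → Fin 7 → Fin 7 → ℂ} (h : IsAlt₃ f) (a b : Fin 7) :
    f a b a = 0 := by rw [h.swap₁₂, h.self₂₃, neg_zero]

theorem IsAlt₃.cycle {f : Fin 7 → Fin 7 → Fin 7 → ℂ} (h : IsAlt₃ f) (a b c : Fin 7) :
    f a b c = f b c a := by rw [h.swap₁₂, h.swap₂₃, neg_neg]

theorem isAlt₃_coord (α : ThreeForm) : IsAlt₃ (coord α) :=
  ⟨coord_swap₁₂ α, coord_swap₂₃ α⟩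

/-- The components of the exterior product of two three-forms, as a sum over shuffles. -/
def wedge₃ (α β : Fin 7 → Fin 7 → Fin 7 → ℂ) (v : Fin 6 → Fin 7) : ℂ :=
  α (v 0) (v 1) (v 2) * β (v 3) (v 4) (v 5) - α (v 0) (v 1) (v 3) * β (v 2) (v 4) (v 5) + α (v
    0) (v 1) (v 4) * β (v 2) (v 3) (v 5) - α (v 0) (v 1) (v 5) * β (v 2) (v 3) (v 4) + α (v 0)
    (v 2) (v 3) * β (v 1) (v 4) (v 5) - α (v 0) (v 2) (v 4) * β (v 1) (v 3) (v 5) + α (v 0) (v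
    2) (v 5) * β (v 1) (v 3) (v 4) + α (v 0) (v 3) (v 4) * β (v 1) (v 2) (v 5) - α (v 0) (v 3)
    (v 5) * β (v 1) (v 2) (v 4) + α (v 0) (v 4) (v 5) * β (v 1) (v 2) (v 3) - α (v 1) (v 2) (v
    3) * β (v 0) (v 4) (v 5) + α (v 1) (v 2) (v 4) * β (v 0) (v 3) (v 5) - α (v 1) (v 2) (v 5)
    * β (v 0) (v 3) (v 4) - α (v 1) (v 3) (v 4) * β (v 0) (v 2) (v 5) + α (v 1) (v 3) (v 5) *
    β (v 0) (v 2) (v 4) - α (v 1) (v 4) (v 5) * β (v 0) (v 2) (v 3) + α (v 2) (v 3) (v 4) * β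
    (v 0) (v 1) (v 5) - α (v 2) (v 3) (v 5) * β (v 0) (v 1) (v 4) + α (v 2) (v 4) (v 5) * β (v
    0) (v 1) (v 3) - α (v 3) (v 4) (v 5) * β (v 0) (v 1) (v 2)

/-- Each of the two products contributes ten terms: one with all of `a, b, c` on the first form, and
nine with two of them there and one on the second. Their difference is the sum of the twenty
shuffles of an exterior product, which exposes an antisymmetry between `a, b, c` and `p, q, r` that
the definition of `K` hides. -/
theorem kantorTensor_basisForm (α β : ThreeForm) (a b c p q r : Fin 7) :
    coord (kantorTensor formTriple α β (basisForm a b c)) p q r =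
      -wedge₃ (coord α) (coord β) ![a, b, c, p, q, r] := by
  rw [kantorTensor_apply, coord_sub, coord_formTriple_basisForm, coord_formTriple_basisForm]
  simp only [wedge₃, Matrix.cons_val]
  have h₁ : ∀ (γ : ThreeForm) i, coord γ i b c = coord γ b c i := fun γ i => coord_cycle γ i b c
  have h₂ : ∀ (γ : ThreeForm) i, coord γ i c a = -coord γ a c i := fun γ i => by
    rw [coord_cycle, coord_swap₁₂]
  have h₃ : ∀ (γ : ThreeForm) i, coord γ i a b = coord γ a b i := fun γ i => coord_cycle γ i a b
  have h₄ : ∀ (γ : ThreeForm) x, coord γ p x r = -coord γ x p r := fun γ x => coord_swap₁₂ γ p x r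
  have h₅ : ∀ (γ : ThreeForm) x, coord γ p q x = coord γ x p q := fun γ x =>
    (coord_cycle γ x p q).symm
  rw [h₁ α p, h₁ α q, h₁ α r, h₁ β p, h₁ β q, h₁ β r, h₂ α p, h₂ α q, h₂ α r, h₂ β p, h₂ β q,
    h₂ β r, h₃ α p, h₃ α q, h₃ α r, h₃ β p, h₃ β q, h₃ β r, h₄ α a, h₄ α b, h₄ α c, h₄ β a,
    h₄ β b, h₄ β c, h₅ α a, h₅ α b, h₅ α c, h₅ β a, h₅ β b, h₅ β c]
  ring

/-- A function of six indices is totally antisymmetric. -/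
def IsAlt₆ (f : (Fin 6 → Fin 7) → ℂ) : Prop :=
  ∀ (σ : Equiv.Perm (Fin 6)) (s : Fin 6 → Fin 7), f (s ∘ σ) = (Equiv.Perm.sign σ : ℤ) * f s

/-- Adjacent transpositions generate the symmetric group. -/
theorem isAlt₆_of_adjacent {f : (Fin 6 → Fin 7) → ℂ}
    (h : ∀ (i : Fin 5) s, f (s ∘ Equiv.swap i.castSucc i.succ) = -f s) : IsAlt₆ f := by
  intro σ
  have hσ : σ ∈ Submonoid.closure
      (Set.range fun i : Fin 5 => Equiv.swap i.castSucc i.succ) := by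
    rw [Equiv.Perm.mclosure_swap_castSucc_succ]; trivial
  induction hσ using Submonoid.closure_induction with
  | mem x hx =>
    obtain ⟨i, rfl⟩ := hx
    intro s
    rw [h, Equiv.Perm.sign_swap (Fin.castSucc_lt_succ).ne]
    simp
  | one => intro s; simp
  | mul x y _ _ hx hy =>
    intro s
    rw [Equiv.Perm.coe_mul, ← Function.comp_assoc, hy, hx, Equiv.Perm.sign_mul]
    push_cast
    ring

theorem IsAlt₆.swap {f : (Fin 6 → Fin 7) → ℂ} (h : IsAlt₆ f) {i j : Fin 6} (hij : i ≠ j)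
    (s : Fin 6 → Fin 7) : f (s ∘ Equiv.swap i j) = -f s := by
  rw [h, Equiv.Perm.sign_swap hij]; simp

theorem IsAlt₆.eq_zero_of_eq {f : (Fin 6 → Fin 7) → ℂ} (h : IsAlt₆ f) {s : Fin 6 → Fin 7}
    {i j : Fin 6} (hij : i ≠ j) (hs : s i = s j) : f s = 0 := by
  have e : s ∘ Equiv.swap i j = s := by
    ext k : 1
    rcases eq_or_ne k i with rfl | hi
    · simp [hs]
    · rcases eq_or_ne k j with rfl | hj
      · simp [hs]
      · simp [Equiv.swap_apply_of_ne_of_ne hi hj]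
  have := h.swap hij s
  rw [e] at this
  exact self_eq_neg.mp this

/-- In dimension seven, a totally antisymmetric tensor with six indices vanishes if its seven
components with indices in a fixed order do. -/
theorem IsAlt₆.eq_zero {f : (Fin 6 → Fin 7) → ℂ} (h : IsAlt₆ f) (σ : Equiv.Perm (Fin 7))
    (hf : ∀ m : Fin 7, f (σ ∘ m.succAbove) = 0) (s : Fin 6 → Fin 7) : f s = 0 := by
  by_cases hs : Function.Injective s
  -- Six distinct indices out of seven miss exactly one, named `σ m`, so `s` is a rearrangement of
  -- `σ ∘ m.succAbove`.
  · obtain ⟨m, hm⟩ : ∃ m, ∀ i, s i ≠ σ m := by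
      by_contra! hc
      have : Function.Surjective s := fun x => by
        obtain ⟨i, hi⟩ := hc (σ.symm x)
        exact ⟨i, by simpa using hi⟩
      simpa using Fintype.card_le_of_surjective s this
    have hex : ∀ i, ∃ k, m.succAbove k = σ.symm (s i) := fun i =>
      Fin.exists_succAbove_eq fun e => hm i (by rw [← e, Equiv.apply_symm_apply])
    choose τ hτ using hex
    have hinj : Function.Injective τ := fun i j hij => by
      have := hτ i
      rw [hij, hτ j] at this
      exact (hs (σ.symm.injective this)).symm
    have hs' : s = (σ ∘ m.succAbove) ∘
        Equiv.ofBijective τ (Finite.injective_iff_bijective.mp hinj) := by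
      ext i : 1
      simp [hτ]
    rw [hs', h, hf, mul_zero]
  · obtain ⟨i, j, hij, hne⟩ : ∃ i j, s i = s j ∧ i ≠ j := by
      simpa [Function.Injective] using hs
    exact h.eq_zero_of_eq hne hij

theorem isAlt₆_wedge₃ {α β : Fin 7 → Fin 7 → Fin 7 → ℂ} (hα : IsAlt₃ α) (hβ : IsAlt₃ β) :
    IsAlt₆ (wedge₃ α β) := by
  refine isAlt₆_of_adjacent fun i s => ?_
  have hs : ∀ t : Fin 6 → Fin 7, t = ![t 0, t 1, t 2, t 3, t 4, t 5] := fun t => by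
    ext k : 1; fin_cases k <;> rfl
  rw [hs (s ∘ _)]
  -- For an adjacent swap, shuffles with both swapped slots on the same form change sign by the
  -- antisymmetry of that form. The others are exchanged in pairs of opposite sign.
  fin_cases i
  · change wedge₃ α β ![s 1, s 0, s 2, s 3, s 4, s 5] = _
    simp only [wedge₃, Matrix.cons_val]
    linear_combination β (s 3) (s 4) (s 5) * hα.swap₁₂ (s 1) (s 0) (s 2) - β (s 2) (s 4) (s 5)
      * hα.swap₁₂ (s 1) (s 0) (s 3) + β (s 2) (s 3) (s 5) * hα.swap₁₂ (s 1) (s 0) (s 4) - β (s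
      2) (s 3) (s 4) * hα.swap₁₂ (s 1) (s 0) (s 5) + α (s 2) (s 3) (s 4) * hβ.swap₁₂ (s 1) (s
      0) (s 5) - α (s 2) (s 3) (s 5) * hβ.swap₁₂ (s 1) (s 0) (s 4) + α (s 2) (s 4) (s 5) *
      hβ.swap₁₂ (s 1) (s 0) (s 3) - α (s 3) (s 4) (s 5) * hβ.swap₁₂ (s 1) (s 0) (s 2)
  · change wedge₃ α β ![s 0, s 2, s 1, s 3, s 4, s 5] = _
    simp only [wedge₃, Matrix.cons_val]
    linear_combination β (s 3) (s 4) (s 5) * hα.swap₂₃ (s 0) (s 2) (s 1) + α (s 0) (s 3) (s 4)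
      * hβ.swap₁₂ (s 2) (s 1) (s 5) - α (s 0) (s 3) (s 5) * hβ.swap₁₂ (s 2) (s 1) (s 4) + α (s
      0) (s 4) (s 5) * hβ.swap₁₂ (s 2) (s 1) (s 3) - β (s 0) (s 4) (s 5) * hα.swap₁₂ (s 2) (s
      1) (s 3) + β (s 0) (s 3) (s 5) * hα.swap₁₂ (s 2) (s 1) (s 4) - β (s 0) (s 3) (s 4) *
      hα.swap₁₂ (s 2) (s 1) (s 5) - α (s 3) (s 4) (s 5) * hβ.swap₂₃ (s 0) (s 2) (s 1)
  · change wedge₃ α β ![s 0, s 1, s 3, s 2, s 4, s 5] = _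
    simp only [wedge₃, Matrix.cons_val]
    linear_combination α (s 0) (s 1) (s 4) * hβ.swap₁₂ (s 3) (s 2) (s 5) - α (s 0) (s 1) (s 5)
      * hβ.swap₁₂ (s 3) (s 2) (s 4) + β (s 1) (s 4) (s 5) * hα.swap₂₃ (s 0) (s 3) (s 2) + α (s
      0) (s 4) (s 5) * hβ.swap₂₃ (s 1) (s 3) (s 2) - β (s 0) (s 4) (s 5) * hα.swap₂₃ (s 1) (s
      3) (s 2) - α (s 1) (s 4) (s 5) * hβ.swap₂₃ (s 0) (s 3) (s 2) + β (s 0) (s 1) (s 5) *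
      hα.swap₁₂ (s 3) (s 2) (s 4) - β (s 0) (s 1) (s 4) * hα.swap₁₂ (s 3) (s 2) (s 5)
  · change wedge₃ α β ![s 0, s 1, s 2, s 4, s 3, s 5] = _
    simp only [wedge₃, Matrix.cons_val]
    linear_combination α (s 0) (s 1) (s 2) * hβ.swap₁₂ (s 4) (s 3) (s 5) - α (s 0) (s 1) (s 5)
      * hβ.swap₂₃ (s 2) (s 4) (s 3) + α (s 0) (s 2) (s 5) * hβ.swap₂₃ (s 1) (s 4) (s 3) + β (s
      1) (s 2) (s 5) * hα.swap₂₃ (s 0) (s 4) (s 3) - α (s 1) (s 2) (s 5) * hβ.swap₂₃ (s 0) (s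
      4) (s 3) - β (s 0) (s 2) (s 5) * hα.swap₂₃ (s 1) (s 4) (s 3) + β (s 0) (s 1) (s 5) *
      hα.swap₂₃ (s 2) (s 4) (s 3) - β (s 0) (s 1) (s 2) * hα.swap₁₂ (s 4) (s 3) (s 5)
  · change wedge₃ α β ![s 0, s 1, s 2, s 3, s 5, s 4] = _
    simp only [wedge₃, Matrix.cons_val]
    linear_combination α (s 0) (s 1) (s 2) * hβ.swap₂₃ (s 3) (s 5) (s 4) - α (s 0) (s 1) (s 3)
      * hβ.swap₂₃ (s 2) (s 5) (s 4) + α (s 0) (s 2) (s 3) * hβ.swap₂₃ (s 1) (s 5) (s 4) + β (s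
      1) (s 2) (s 3) * hα.swap₂₃ (s 0) (s 5) (s 4) - α (s 1) (s 2) (s 3) * hβ.swap₂₃ (s 0) (s
      5) (s 4) - β (s 0) (s 2) (s 3) * hα.swap₂₃ (s 1) (s 5) (s 4) + β (s 0) (s 1) (s 3) *
      hα.swap₂₃ (s 2) (s 5) (s 4) - β (s 0) (s 1) (s 2) * hα.swap₂₃ (s 3) (s 5) (s 4)

/-- The action on a tensor `ω` with six indices of the element `M(y, e^{abc})` of `𝔤𝔩(7)`. -/
def act₆ (y : Fin 7 → Fin 7 → Fin 7 → ℂ) (a b c : Fin 7) (ω : (Fin 6 → Fin 7) → ℂ)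
    (s : Fin 6 → Fin 7) : ℂ :=
  -2 * y a b c * ω s + ∑ i, (y (s i) b c * ω (Function.update s i a)
    + y (s i) c a * ω (Function.update s i b) + y (s i) a b * ω (Function.update s i c))

theorem isAlt₆_act₆ (y : Fin 7 → Fin 7 → Fin 7 → ℂ) (a b c : Fin 7) {ω : (Fin 6 → Fin 7) → ℂ}
    (hω : IsAlt₆ ω) : IsAlt₆ (act₆ y a b c ω) := by
  intro σ s
  have h : ∀ i x, Function.update (s ∘ σ) i x = Function.update s (σ i) x ∘ σ := fun i x => by
    rw [Function.update_comp_equiv, Equiv.symm_apply_apply]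
  simp only [act₆, h, hω σ, Function.comp_apply]
  rw [Equiv.sum_comp σ fun j => y (s j) b c * ((Equiv.Perm.sign σ : ℤ) * ω (Function.update s j a))
    + y (s j) c a * ((Equiv.Perm.sign σ : ℤ) * ω (Function.update s j b))
    + y (s j) a b * ((Equiv.Perm.sign σ : ℤ) * ω (Function.update s j c)), mul_add,
    Finset.mul_sum]
  congr 1
  · ring
  · exact Finset.sum_congr rfl fun i _ => by ring

theorem IsAlt₆.isAlt₃ {ω : (Fin 6 → Fin 7) → ℂ} (hω : IsAlt₆ ω) (a b c : Fin 7) :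
    IsAlt₃ fun p q r => ω ![a, b, c, p, q, r] := by
  refine ⟨fun p q r => ?_, fun p q r => ?_⟩
  · rw [← hω.swap (i := 3) (j := 4) (by decide)]
    congr 1; ext k : 1; fin_cases k <;> rfl
  · rw [← hω.swap (i := 4) (j := 5) (by decide)]
    congr 1; ext k : 1; fin_cases k <;> rfl

theorem update₆_zero (a b c d e g x : Fin 7) :
    Function.update ![a, b, c, d, e, g] 0 x = ![x, b, c, d, e, g] := by
  ext k : 1; fin_cases k <;> rfl

theorem update₆_one (a b c d e g x : Fin 7) :
    Function.update ![a, b, c, d, e, g] 1 x = ![a, x, c, d, e, g] := by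
  ext k : 1; fin_cases k <;> rfl

theorem update₆_two (a b c d e g x : Fin 7) :
    Function.update ![a, b, c, d, e, g] 2 x = ![a, b, x, d, e, g] := by
  ext k : 1; fin_cases k <;> rfl

theorem update₆_three (a b c d e g x : Fin 7) :
    Function.update ![a, b, c, d, e, g] 3 x = ![a, b, c, x, e, g] := by
  ext k : 1; fin_cases k <;> rfl

theorem update₆_four (a b c d e g x : Fin 7) :
    Function.update ![a, b, c, d, e, g] 4 x = ![a, b, c, d, x, g] := by
  ext k : 1; fin_cases k <;> rfl

theorem update₆_five (a b c d e g x : Fin 7) :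
    Function.update ![a, b, c, d, e, g] 5 x = ![a, b, c, d, e, x] := by
  ext k : 1; fin_cases k <;> rfl

/-- The seven components of the six-form identity, once the contracted indices have been renamed `f
0, f 1, f 2`. If the omitted index is one of these three, most values of `ω` vanish by repetition;
the other four components are instances of a single computation. -/
theorem wedge₃_contract_sorted (y : Fin 7 → Fin 7 → Fin 7 → ℂ) (hy : IsAlt₃ y)
    {ω : (Fin 6 → Fin 7) → ℂ} (hω : IsAlt₆ ω) (f : Fin 7 → Fin 7) (m : Fin 7) :
    wedge₃ (fun p q r => ω ![f 0, f 1, f 2, p, q, r]) y (f ∘ m.succAbove)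
      + act₆ y (f 0) (f 1) (f 2) ω (f ∘ m.succAbove) = 0 := by
  have z₀₃ : ∀ a b c d e, ω ![a, b, c, a, d, e] = 0 := fun _ _ _ _ _ =>
    hω.eq_zero_of_eq (i := 0) (j := 3) (by decide) rfl
  have z₀₄ : ∀ a b c d e, ω ![a, b, c, d, a, e] = 0 := fun _ _ _ _ _ =>
    hω.eq_zero_of_eq (i := 0) (j := 4) (by decide) rfl
  have z₀₅ : ∀ a b c d e, ω ![a, b, c, d, e, a] = 0 := fun _ _ _ _ _ =>
    hω.eq_zero_of_eq (i := 0) (j := 5) (by decide) rfl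
  have z₁₃ : ∀ a b c d e, ω ![b, a, c, a, d, e] = 0 := fun _ _ _ _ _ =>
    hω.eq_zero_of_eq (i := 1) (j := 3) (by decide) rfl
  have z₁₄ : ∀ a b c d e, ω ![b, a, c, d, a, e] = 0 := fun _ _ _ _ _ =>
    hω.eq_zero_of_eq (i := 1) (j := 4) (by decide) rfl
  have z₁₅ : ∀ a b c d e, ω ![b, a, c, d, e, a] = 0 := fun _ _ _ _ _ =>
    hω.eq_zero_of_eq (i := 1) (j := 5) (by decide) rfl
  have z₂₃ : ∀ a b c d e, ω ![b, c, a, a, d, e] = 0 := fun _ _ _ _ _ =>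
    hω.eq_zero_of_eq (i := 2) (j := 3) (by decide) rfl
  have z₂₄ : ∀ a b c d e, ω ![b, c, a, d, a, e] = 0 := fun _ _ _ _ _ =>
    hω.eq_zero_of_eq (i := 2) (j := 4) (by decide) rfl
  have z₂₅ : ∀ a b c d e, ω ![b, c, a, d, e, a] = 0 := fun _ _ _ _ _ =>
    hω.eq_zero_of_eq (i := 2) (j := 5) (by decide) rfl
  have z₀₁ : ∀ a b c d e, ω ![a, a, b, c, d, e] = 0 := fun _ _ _ _ _ =>
    hω.eq_zero_of_eq (i := 0) (j := 1) (by decide) rfl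
  have z₀₂ : ∀ a b c d e, ω ![a, b, a, c, d, e] = 0 := fun _ _ _ _ _ =>
    hω.eq_zero_of_eq (i := 0) (j := 2) (by decide) rfl
  have z₁₂ : ∀ a b c d e, ω ![b, a, a, c, d, e] = 0 := fun _ _ _ _ _ =>
    hω.eq_zero_of_eq (i := 1) (j := 2) (by decide) rfl
  have s₀₁ : ∀ a b c d e g, ω ![a, b, c, d, e, g] = -ω ![b, a, c, d, e, g] := fun a b c d e g => by
    rw [← hω.swap (i := 0) (j := 1) (by decide)]
    congr 1; ext k : 1; fin_cases k <;> rfl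
  have s₁₂ : ∀ a b c d e g, ω ![a, b, c, d, e, g] = -ω ![a, c, b, d, e, g] := fun a b c d e g => by
    rw [← hω.swap (i := 1) (j := 2) (by decide)]
    congr 1; ext k : 1; fin_cases k <;> rfl
  have s₂₃ : ∀ a b c d e g, ω ![a, b, c, d, e, g] = -ω ![a, b, d, c, e, g] := fun a b c d e g => by
    rw [← hω.swap (i := 2) (j := 3) (by decide)]
    congr 1; ext k : 1; fin_cases k <;> rfl
  have s₃₄ : ∀ a b c d e g, ω ![a, b, c, d, e, g] = -ω ![a, b, c, e, d, g] := fun a b c d e g => by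
    rw [← hω.swap (i := 3) (j := 4) (by decide)]
    congr 1; ext k : 1; fin_cases k <;> rfl
  have s₄₅ : ∀ a b c d e g, ω ![a, b, c, d, e, g] = -ω ![a, b, c, d, g, e] := fun a b c d e g => by
    rw [← hω.swap (i := 4) (j := 5) (by decide)]
    congr 1; ext k : 1; fin_cases k <;> rfl
  -- The families `m`, `n`, `l` bring the entry of a later slot to slot `0`, `1`, `2` respectively.
  -- They put the missing index back in its place among `a, b, c` in the cases `omit0`, `omit1`,
  -- `omit2`.
  have m₃ : ∀ a b c d e g, ω ![a, b, c, d, e, g] = -ω ![d, a, b, c, e, g] := fun a b c d e g => by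
    rw [s₂₃, s₁₂, s₀₁, neg_neg]
  have m₄ : ∀ a b c d e g, ω ![a, b, c, d, e, g] = ω ![e, a, b, c, d, g] := fun a b c d e g => by
    rw [s₃₄, m₃, neg_neg]
  have m₅ : ∀ a b c d e g, ω ![a, b, c, d, e, g] = -ω ![g, a, b, c, d, e] := fun a b c d e g => by
    rw [s₄₅, m₄]
  have m₂ : ∀ a b c d e g, ω ![a, b, c, d, e, g] = ω ![c, a, b, d, e, g] := fun a b c d e g => by
    rw [s₁₂, s₀₁, neg_neg]
  have n₃ : ∀ a b c d e g, ω ![a, b, c, d, e, g] = ω ![a, d, b, c, e, g] := fun a b c d e g => by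
    rw [s₂₃, s₁₂, neg_neg]
  have n₄ : ∀ a b c d e g, ω ![a, b, c, d, e, g] = -ω ![a, e, b, c, d, g] := fun a b c d e g => by
    rw [s₃₄, n₃]
  have n₅ : ∀ a b c d e g, ω ![a, b, c, d, e, g] = ω ![a, g, b, c, d, e] := fun a b c d e g => by
    rw [s₄₅, n₄, neg_neg]
  have l₄ : ∀ a b c d e g, ω ![a, b, c, d, e, g] = ω ![a, b, e, c, d, g] := fun a b c d e g => by
    rw [s₃₄, s₂₃, neg_neg]
  have l₅ : ∀ a b c d e g, ω ![a, b, c, d, e, g] = -ω ![a, b, g, c, d, e] := fun a b c d e g => by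
    rw [s₄₅, l₄]
  have hs : f ∘ m.succAbove = ![f (m.succAbove 0), f (m.succAbove 1), f (m.succAbove 2),
      f (m.succAbove 3), f (m.succAbove 4), f (m.succAbove 5)] := by
    ext k : 1; fin_cases k <;> rfl
  have generic : ∀ a b c x y' z : Fin 7,
      wedge₃ (fun p q r => ω ![a, b, c, p, q, r]) y ![a, b, c, x, y', z]
      + act₆ y a b c ω ![a, b, c, x, y', z] = 0 := fun a b c x y' z => by
    simp only [wedge₃, act₆, Fin.sum_univ_six, Matrix.cons_val, update₆_zero, update₆_one,
      update₆_two, update₆_three, update₆_four, update₆_five, z₀₃, z₀₄,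
      z₀₅, z₁₃, z₁₄, z₁₅, z₂₃, z₂₄, z₂₅, z₀₁, z₀₂, z₁₂, hy.self₁₂, hy.self₁₃]
    rw [hy.cycle c a b, hy.cycle b c a, hy.cycle c a b]
    ring
  have omit0 : ∀ a b c d e g h : Fin 7,
      wedge₃ (fun p q r => ω ![a, b, c, p, q, r]) y ![b, c, d, e, g, h]
      + act₆ y a b c ω ![b, c, d, e, g, h] = 0 := fun a b c d e g h => by
    simp only [wedge₃, act₆, Fin.sum_univ_six, Matrix.cons_val, update₆_zero, update₆_one,
      update₆_two, update₆_three, update₆_four, update₆_five, z₀₃, z₀₄,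
      z₀₅, z₁₃, z₁₄, z₁₅, z₂₃, z₀₁, z₀₂, z₁₂, hy.self₁₂, hy.self₁₃, mul_zero,
      zero_mul, add_zero, zero_add, sub_zero]
    rw [m₂ b c a, m₃ b c d a, m₄ b c d e a, m₅ b c d e g a, ← hy.cycle a b c, hy.cycle c a b,
      hy.cycle d b c, hy.cycle e b c, hy.cycle g b c, hy.cycle h b c]
    ring
  have omit1 : ∀ a b c d e g h : Fin 7,
      wedge₃ (fun p q r => ω ![a, b, c, p, q, r]) y ![a, c, d, e, g, h]
      + act₆ y a b c ω ![a, c, d, e, g, h] = 0 := fun a b c d e g h => by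
    simp only [wedge₃, act₆, Fin.sum_univ_six, Matrix.cons_val, update₆_zero, update₆_one,
      update₆_two, update₆_three, update₆_four, update₆_five, z₀₃, z₀₄,
      z₀₅, z₁₃, z₁₄, z₁₅, z₂₃, z₀₁, z₀₂, z₁₂, hy.self₁₂, hy.self₁₃, mul_zero,
      zero_mul, add_zero, zero_add, sub_zero]
    rw [s₁₂ a c b, n₃ a c d b, n₄ a c d e b, n₅ a c d e g b, hy.cycle c a b, hy.cycle d c a,
      hy.cycle e c a, hy.cycle g c a, hy.cycle h c a, hy.swap₁₂ c a d, hy.swap₁₂ c a e,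
      hy.swap₁₂ c a g, hy.swap₁₂ c a h]
    ring
  have omit2 : ∀ a b c d e g h : Fin 7,
      wedge₃ (fun p q r => ω ![a, b, c, p, q, r]) y ![a, b, d, e, g, h]
      + act₆ y a b c ω ![a, b, d, e, g, h] = 0 := fun a b c d e g h => by
    simp only [wedge₃, act₆, Fin.sum_univ_six, Matrix.cons_val, update₆_zero, update₆_one,
      update₆_two, update₆_three, update₆_four, update₆_five, z₀₃, z₀₄,
      z₀₅, z₁₃, z₁₄, z₁₅, z₀₁, z₀₂, z₁₂, hy.self₁₂, hy.self₁₃, mul_zero,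
      zero_mul, add_zero, zero_add, sub_zero]
    rw [s₂₃ a b d c, l₄ a b d e c, l₅ a b d e g c, ← hy.cycle a b c, hy.cycle d a b,
      hy.cycle e a b, hy.cycle g a b, hy.cycle h a b]
    ring
  rw [hs]
  fin_cases m
  · exact omit0 _ _ _ _ _ _ _
  · exact omit1 _ _ _ _ _ _ _
  · exact omit2 _ _ _ _ _ _ _
  all_goals exact generic _ _ _ _ _ _

theorem exists_perm_apply {a b c : Fin 7} (hab : a ≠ b) (hac : a ≠ c) (hbc : b ≠ c) :
    ∃ σ : Equiv.Perm (Fin 7), σ 0 = a ∧ σ 1 = b ∧ σ 2 = c := by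
  let x : Fin 3 ↪ Fin 7 := ⟨![0, 1, 2], by decide⟩
  let y : Fin 3 ↪ Fin 7 := ⟨![a, b, c], by
    intro i j h
    fin_cases i <;> fin_cases j <;> simp_all⟩
  have : MulAction.IsPretransitive (Equiv.Perm (Fin 7)) (Fin 3 ↪ Fin 7) :=
    Equiv.Perm.isMultiplyPretransitive (Fin 7) 3
  obtain ⟨σ, hσ⟩ := MulAction.exists_smul_eq (Equiv.Perm (Fin 7)) x y
  exact ⟨σ, DFunLike.congr_fun hσ 0, DFunLike.congr_fun hσ 1, DFunLike.congr_fun hσ 2⟩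

/-- The heart of identity (ii). Both terms are totally antisymmetric in `s`, so seven components
suffice; the permutation carrying `0, 1, 2` to `a, b, c` reduces these to the sorted case. -/
theorem wedge₃_contract (y : Fin 7 → Fin 7 → Fin 7 → ℂ) (hy : IsAlt₃ y)
    {ω : (Fin 6 → Fin 7) → ℂ} (hω : IsAlt₆ ω) {a b c : Fin 7} (hab : a ≠ b) (hac : a ≠ c)
    (hbc : b ≠ c) (s : Fin 6 → Fin 7) :
    wedge₃ (fun p q r => ω ![a, b, c, p, q, r]) y s + act₆ y a b c ω s = 0 := by
  obtain ⟨σ, rfl, rfl, rfl⟩ := exists_perm_apply hab hac hbc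
  refine IsAlt₆.eq_zero (f := fun s => wedge₃ (fun p q r => ω ![σ 0, σ 1, σ 2, p, q, r]) y s
    + act₆ y (σ 0) (σ 1) (σ 2) ω s) (fun τ t => ?_) σ
    (fun m => wedge₃_contract_sorted y hy hω σ m) s
  simp only [isAlt₆_wedge₃ (hω.isAlt₃ _ _ _) hy τ, isAlt₆_act₆ y _ _ _ hω τ]
  ring

/-- The Leibniz rule for `M(y, e^{abc})` on an exterior product. Its scalar part `y_{abc}/3` acts by
`-y_{abc}` on each three-form, whence the coefficient `-2` in `act₆`. -/
theorem wedge₃_formTriple (u v y : ThreeForm) (a b c p q r i j k : Fin 7) :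
    wedge₃ (coord (formTriple y (basisForm a b c) u)) (coord v) ![p, q, r, i, j, k]
      + wedge₃ (coord u) (coord (formTriple y (basisForm a b c) v)) ![p, q, r, i, j, k] =
    act₆ (coord y) a b c (wedge₃ (coord u) (coord v)) ![p, q, r, i, j, k] := by
  simp only [act₆, Fin.sum_univ_six, Matrix.cons_val, update₆_zero, update₆_one,
    update₆_two, update₆_three, update₆_four, update₆_five, wedge₃,
    coord_formTriple_basisForm]
  ring

/-- By linearity `x = e^{abc}`, and both sides are evaluated on some `e^{deg}`. With `ω = u ∧ v` the
left side becomes `(ι_{abc} ω) ∧ y`. Exterior products of three-forms anticommute, so the right side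
is `-M(y, e^{abc}) · ω`. -/
theorem kantorTensor_kantorTensor (u v x y : ThreeForm) :
    kantorTensor formTriple (kantorTensor formTriple u v x) y =
      kantorTensor formTriple (formTriple y x u) v -
        kantorTensor formTriple (formTriple y x v) u := by
  suffices h : (kantorTensor formTriple).flip y ∘ₗ kantorTensor formTriple u v =
      (kantorTensor formTriple).flip v ∘ₗ (formTriple y).flip u -
        (kantorTensor formTriple).flip u ∘ₗ (formTriple y).flip v from LinearMap.congr_fun h x
  refine threeForm_linearMap_ext fun a b c hab hac hbc => threeForm_linearMap_ext
    fun d e g _ _ _ => ext_coord fun p q r => ?_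
  simp only [LinearMap.comp_apply, LinearMap.flip_apply, LinearMap.sub_apply, coord_sub,
    kantorTensor_basisForm]
  have h₁ : coord (kantorTensor formTriple u v (basisForm a b c)) =
      fun i j k => -wedge₃ (coord u) (coord v) ![a, b, c, i, j, k] := by
    funext i j k
    exact kantorTensor_basisForm _ _ _ _ _ _ _ _
  have h₂ : ∀ α β : ThreeForm, wedge₃ (coord α) (coord β) ![d, e, g, p, q, r] =
      -wedge₃ (coord β) (coord α) ![d, e, g, p, q, r] := fun α β => by
    simp only [wedge₃]; ring
  have h₃ := wedge₃_contract (coord y) (isAlt₃_coord y)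
    (isAlt₆_wedge₃ (isAlt₃_coord u) (isAlt₃_coord v)) hab hac hbc ![d, e, g, p, q, r]
  have h₄ := wedge₃_formTriple u v y a b c d e g p q r
  have h₅ : ∀ (f : Fin 7 → Fin 7 → Fin 7 → ℂ), wedge₃ (fun i j k => -f i j k) (coord y)
      ![d, e, g, p, q, r] = -wedge₃ f (coord y) ![d, e, g, p, q, r] := fun f => by
    simp only [wedge₃]; ring
  rw [h₁, h₅, h₂ _ u]
  linear_combination h₃ + h₄

/-- The Kantor triple system on three-forms. -/
def formKTS : KantorTripleSystem ThreeForm where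
  triple := formTriple
  triple_triple := formTriple_formTriple
  kantor_kantor := kantorTensor_kantorTensor

theorem formKTS_triple : formKTS.triple = formTriple := rfl

/-! ### Irreducibility and `K`-simplicity -/

theorem coord_rho_single (i j : Fin 7) (α : ThreeForm) (a b c : Fin 7) :
    coord (rho (Matrix.single i j 1) α) a b c =
      -kron j a * coord α i b c - kron j b * coord α a i c - kron j c * coord α a b i := by
  have h : ∀ (m : Fin 7) (f : Fin 7 → ℂ),
      ∑ n, (Matrix.single i j 1 : Matrix (Fin 7) (Fin 7) ℂ) n m * f n = kron j m * f i := by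
    intro m f
    rw [Finset.sum_eq_single i]
    · simp [Matrix.single_apply, kron]
    · intro n _ hn
      simp [hn.symm]
    · simp
  rw [coord_rho, h a fun n => coord α n b c, h b fun n => coord α a n c, h c fun n => coord α a b n]
  ring

theorem rho_single_basisForm (i j a b c : Fin 7) : rho (Matrix.single i j 1) (basisForm a b c) =
    -(kron i a • basisForm j b c + kron i b • basisForm a j c + kron i c • basisForm a b j) := by
  refine ext_coord fun p q r => ?_
  rw [coord_rho_single]
  simp only [coord_neg, coord_add, coord_smul, coord_basisForm, kron_comm j]
  ring

theorem coord_rho_single_self (i : Fin 7) (α : ThreeForm) (a b c : Fin 7) :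
    coord (rho (Matrix.single i i 1) α) a b c =
      -(kron i a + kron i b + kron i c) * coord α a b c := by
  have h : ∀ (m : Fin 7) (f : Fin 7 → ℂ), kron i m * f i = kron i m * f m := fun m f => by
    by_cases hm : i = m
    · rw [hm]
    · rw [kron_of_ne hm, zero_mul, zero_mul]
  rw [coord_rho_single, neg_mul, h a fun n => coord α n b c, h b fun n => coord α a n c,
    h c fun n => coord α a b n]
  ring

/-- The diagonal unit `E_{aa}` multiplies a component by minus the number of its indices equal to
`a`. The product over `a, b, c` therefore keeps only components containing all three, with sign
`(-1)³`: up to sign it is a projection onto a weight line. -/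
theorem rho_single_self_mul (α : ThreeForm) {a b c : Fin 7} (hab : a ≠ b) (hac : a ≠ c)
    (hbc : b ≠ c) :
    rho (Matrix.single a a 1) (rho (Matrix.single b b 1) (rho (Matrix.single c c 1) α)) =
      -coord α a b c • basisForm a b c := by
  refine ext_coord fun p q r => ?_
  simp only [coord_rho_single_self, coord_smul, coord_basisForm, kron_comm p, kron_comm q,
    kron_comm r]
  have key : ∀ x : Fin 7, (kron a x = 1 ∧ kron b x = 0 ∧ kron c x = 0 ∧ x = a) ∨
      (kron a x = 0 ∧ kron b x = 1 ∧ kron c x = 0 ∧ x = b) ∨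
      (kron a x = 0 ∧ kron b x = 0 ∧ kron c x = 1 ∧ x = c) ∨
      (kron a x = 0 ∧ kron b x = 0 ∧ kron c x = 0 ∧ True) := by
    intro x
    by_cases h₁ : x = a
    · subst h₁; simp [kron, hab.symm, hac.symm]
    by_cases h₂ : x = b
    · subst h₂; simp [kron, hab, hbc.symm]
    by_cases h₃ : x = c
    · subst h₃; simp [kron, hac, hbc]
    · simp [kron, Ne.symm h₁, Ne.symm h₂, Ne.symm h₃]
  rcases key p with ⟨p₁, p₂, p₃, hp⟩ | ⟨p₁, p₂, p₃, hp⟩ | ⟨p₁, p₂, p₃, hp⟩ | ⟨p₁, p₂, p₃, hp⟩ <;>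
  rcases key q with ⟨q₁, q₂, q₃, hq⟩ | ⟨q₁, q₂, q₃, hq⟩ | ⟨q₁, q₂, q₃, hq⟩ | ⟨q₁, q₂, q₃, hq⟩ <;>
  rcases key r with ⟨r₁, r₂, r₃, hr⟩ | ⟨r₁, r₂, r₃, hr⟩ | ⟨r₁, r₂, r₃, hr⟩ | ⟨r₁, r₂, r₃, hr⟩ <;>
  rw [p₁, p₂, p₃, q₁, q₂, q₃, r₁, r₂, r₃] <;>
  first
    | ring1
    | (rw [hp, hq, hr]; ring1)
    | (rw [hp, hq, hr, ← coord_cycle α a b c]; ring1)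
    | (rw [hp, hq, hr, coord_cycle α c a b]; ring1)
    | (rw [hp, hq, hr, coord_swap₁₂ α b a c]; ring1)
    | (rw [hp, hq, hr, coord_swap₂₃ α a c b]; ring1)
    | (rw [hp, hq, hr, coord_cycle α c b a, coord_swap₁₂ α b a c]; ring1)

/-- The action of `𝔤𝔩(7)` on three-forms is irreducible. -/
theorem eq_top_of_rho_mem {I : Submodule ℂ ThreeForm} (hI : I ≠ ⊥)
    (h : ∀ (A : Matrix (Fin 7) (Fin 7) ℂ), ∀ α ∈ I, rho A α ∈ I) : I = ⊤ := by
  obtain ⟨α, hα, hne⟩ := I.exists_mem_ne_zero_of_ne_bot hI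
  obtain ⟨a, b, c, habc⟩ : ∃ a b c, coord α a b c ≠ 0 := by
    by_contra! hc
    exact hne (ext_coord hc)
  have hab : a ≠ b := by rintro rfl; simp at habc
  have hac : a ≠ c := by rintro rfl; simp at habc
  have hbc : b ≠ c := by rintro rfl; simp at habc
  -- The weight projection extracts a basis form from any nonzero element; matrix units then change
  -- its indices one at a time.
  have h₀ : basisForm a b c ∈ I := by
    have := h (Matrix.single a a 1) _ (h (Matrix.single b b 1) _ (h (Matrix.single c c 1) _ hα))
    rw [rho_single_self_mul α hab hac hbc] at this
    exact (I.smul_mem_iff (neg_ne_zero.mpr habc)).mp this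
  have cyc : ∀ {a b c}, basisForm a b c ∈ I → basisForm b c a ∈ I := fun {a b c} hm => by
    rwa [← basisForm_cycle]
  have swp : ∀ {a b c}, basisForm a b c ∈ I → basisForm b a c ∈ I := fun {a b c} hm => by
    rw [basisForm_swap]; exact I.neg_mem hm
  have step : ∀ {a b c}, a ≠ b → a ≠ c → basisForm a b c ∈ I → ∀ p, basisForm p b c ∈ I := by
    intro a b c hab hac hm p
    have := h (Matrix.single a p 1) _ hm
    rw [rho_single_basisForm, kron_self, kron_of_ne hab, kron_of_ne hac] at this
    simpa using this
  -- put `p` into the first slot, then `q` into the second, then `r` into the third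
  have fill₁ : ∀ p, ∃ b c, p ≠ b ∧ p ≠ c ∧ b ≠ c ∧ basisForm p b c ∈ I := by
    intro p
    by_cases h₁ : p = b
    · exact ⟨c, a, h₁ ▸ hbc, h₁ ▸ hab.symm, hac.symm, h₁ ▸ cyc h₀⟩
    by_cases h₂ : p = c
    · exact ⟨a, b, h₂ ▸ hac.symm, h₂ ▸ hbc.symm, hab, h₂ ▸ cyc (cyc h₀)⟩
    · exact ⟨b, c, h₁, h₂, hbc, step hab hac h₀ p⟩
  have fill₂ : ∀ p q, p ≠ q → ∃ c, p ≠ c ∧ q ≠ c ∧ basisForm p q c ∈ I := by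
    intro p q hpq
    obtain ⟨b, c, hpb, hpc, hbc, hm⟩ := fill₁ p
    by_cases h₁ : q = c
    · exact ⟨b, hpb, h₁ ▸ hbc.symm, h₁ ▸ swp (cyc (cyc hm))⟩
    · exact ⟨c, hpc, h₁, swp (step hpb.symm hbc (swp hm) q)⟩
  rw [eq_top_iff]
  rintro γ -
  rw [eq_sum_basisForm γ]
  refine I.sum_mem fun p _ => I.sum_mem fun q _ => I.sum_mem fun r _ => I.smul_mem _ ?_
  by_cases hpq : p = q
  · rw [basisForm_eq_zero (Or.inl hpq)]; exact I.zero_mem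
  obtain ⟨c, hpc, hqc, hm⟩ := fill₂ p q hpq
  exact cyc (step hpc.symm hqc.symm (cyc (cyc hm)) r)

/-- A space of matrices which contains the off-diagonal matrix units, the differences of the
diagonal ones and some `M(e^{abc}, e^{abc})` contains all matrices. -/
theorem eq_top_of_single_mem {N : Submodule ℂ (Matrix (Fin 7) (Fin 7) ℂ)}
    (h₁ : ∀ i j, i ≠ j → Matrix.single i j 1 ∈ N)
    (h₂ : ∀ i j, Matrix.single i i 1 - Matrix.single j j 1 ∈ N)
    {a b c : Fin 7} (h₃ : (1 / 3 : ℂ) • 1 -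
      (Matrix.single a a 1 + Matrix.single b b 1 + Matrix.single c c 1) ∈ N) : N = ⊤ := by
  have hone : (1 : Matrix (Fin 7) (Fin 7) ℂ) = ∑ j, Matrix.single j j 1 :=
    (Matrix.sum_single_one (m := Fin 7) (α := ℂ)).symm
  have h₄ : ∀ i, (7 : ℂ) • Matrix.single i i (1 : ℂ) - 1 ∈ N := fun i => by
    have : (7 : ℂ) • Matrix.single i i (1 : ℂ) - 1 =
        ∑ j, (Matrix.single i i 1 - Matrix.single j j 1) := by
      rw [Finset.sum_sub_distrib, ← hone]
      simp [← Nat.cast_smul_eq_nsmul ℂ]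
    rw [this]
    exact N.sum_mem fun j _ => h₂ i j
  have h₅ : (1 : Matrix (Fin 7) (Fin 7) ℂ) ∈ N := by
    -- Cancelling the diagonal units in `h₃` leaves the scalar `1/3 - 3/7 = -2/21`, the inverse of
    -- the factor in front.
    have e : (1 : Matrix (Fin 7) (Fin 7) ℂ) = (-(21 / 2) : ℂ) • ((1 / 3 : ℂ) • 1 -
        (Matrix.single a a 1 + Matrix.single b b 1 + Matrix.single c c 1)
        + (1 / 7 : ℂ) • ((7 : ℂ) • Matrix.single a a (1 : ℂ) - 1)
        + (1 / 7 : ℂ) • ((7 : ℂ) • Matrix.single b b (1 : ℂ) - 1)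
        + (1 / 7 : ℂ) • ((7 : ℂ) • Matrix.single c c (1 : ℂ) - 1)) := by module
    rw [e]
    exact N.smul_mem _ (N.add_mem (N.add_mem (N.add_mem h₃ (N.smul_mem _ (h₄ a)))
      (N.smul_mem _ (h₄ b))) (N.smul_mem _ (h₄ c)))
  have h₆ : ∀ i j, Matrix.single i j 1 ∈ N := by
    intro i j
    by_cases hij : i = j
    · subst hij
      have e : Matrix.single i i (1 : ℂ) = (1 / 7 : ℂ) • ((7 : ℂ) • Matrix.single i i (1 : ℂ) - 1)
        + (1 / 7 : ℂ) • 1 := by module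
      rw [e]
      exact N.add_mem (N.smul_mem _ (h₄ i)) (N.smul_mem _ h₅)
    · exact h₁ i j hij
  rw [eq_top_iff]
  rintro A -
  rw [Matrix.matrix_eq_sum_single A]
  refine N.sum_mem fun i _ => N.sum_mem fun j _ => ?_
  have : Matrix.single i j (A i j) = A i j • Matrix.single i j 1 := by simp
  rw [this]
  exact N.smul_mem _ (h₆ i j)

theorem tripleMatrix_basisForm_self {a b c : Fin 7} (hab : a ≠ b) (hac : a ≠ c) (hbc : b ≠ c) :
    tripleMatrix (basisForm a b c) (basisForm a b c) = (1 / 3 : ℂ) • 1 -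
      (Matrix.single a a 1 + Matrix.single b b 1 + Matrix.single c c 1) := by
  ext n p
  have h : ∀ x, (Matrix.single x x 1 : Matrix (Fin 7) (Fin 7) ℂ) n p = kron n x * kron p x :=
    fun x => by
      simp only [Matrix.single_apply, kron, eq_comm (a := x)]
      split_ifs <;> simp_all
  have h' : (1 : Matrix (Fin 7) (Fin 7) ℂ) n p = kron n p := Matrix.one_apply
  rw [tripleMatrix_basisForm]
  simp only [Matrix.sub_apply, Matrix.add_apply, Matrix.smul_apply, h, h', coord_basisForm,
    kron_self, kron_of_ne hab, kron_of_ne hac, kron_of_ne hbc, kron_of_ne hab.symm,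
    kron_of_ne hac.symm, kron_of_ne hbc.symm, smul_eq_mul]
  ring

theorem tripleMatrix_basisForm_ne {i j b c : Fin 7} (hij : i ≠ j) (hib : i ≠ b) (hic : i ≠ c)
    (hjb : j ≠ b) (hjc : j ≠ c) (hbc : b ≠ c) :
    tripleMatrix (basisForm j b c) (basisForm i b c) = -Matrix.single i j 1 := by
  ext n p
  have h : (Matrix.single i j 1 : Matrix (Fin 7) (Fin 7) ℂ) n p = kron n i * kron p j := by
      simp only [Matrix.single_apply, kron, eq_comm (a := i), eq_comm (a := j)]
      split_ifs <;> simp_all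
  rw [tripleMatrix_basisForm]
  simp only [Matrix.neg_apply, h, coord_basisForm,
    kron_self, kron_of_ne hij, kron_of_ne hib, kron_of_ne hic, kron_of_ne hbc,
    kron_of_ne hjb.symm, kron_of_ne hjc.symm, kron_of_ne hbc.symm]
  ring

theorem exists_two_ne (i j : Fin 7) :
    ∃ b c : Fin 7, i ≠ b ∧ i ≠ c ∧ j ≠ b ∧ j ≠ c ∧ b ≠ c := by
  revert i j; decide

/-- The matrices `M(α, β)` span `𝔤𝔩(7)`. -/
theorem eq_top_of_tripleMatrix_mem {N : Submodule ℂ (Matrix (Fin 7) (Fin 7) ℂ)}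
    (h : ∀ α β, tripleMatrix α β ∈ N) : N = ⊤ := by
  refine eq_top_of_single_mem (a := 0) (b := 1) (c := 2) (fun i j hij => ?_) (fun i j => ?_) ?_
  · obtain ⟨b, c, hib, hic, hjb, hjc, hbc⟩ := exists_two_ne i j
    have := h (basisForm j b c) (basisForm i b c)
    rw [tripleMatrix_basisForm_ne hij hib hic hjb hjc hbc] at this
    exact N.neg_mem_iff.mp this
  · obtain ⟨b, c, hib, hic, hjb, hjc, hbc⟩ := exists_two_ne i j
    have := N.sub_mem (h (basisForm j b c) (basisForm j b c))
      (h (basisForm i b c) (basisForm i b c))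
    rw [tripleMatrix_basisForm_self hib hic hbc, tripleMatrix_basisForm_self hjb hjc hbc] at this
    convert this using 1
    abel
  · rw [← tripleMatrix_basisForm_self (by decide) (by decide) (by decide)]
    exact h _ _

theorem formKTS_isKSimple : formKTS.IsKSimple := by
  refine ⟨fun h => ?_, fun I hI => ?_⟩
  · have h₁ := congrArg (fun t => coord (t (basisForm 0 1 2) (basisForm 0 1 2)
      (basisForm 0 1 2)) 0 1 2) h
    simp only [formKTS_triple, coord_formTriple_basisForm] at h₁
    simp [coord_basisForm, kron] at h₁
  · by_cases hb : I = ⊥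
    · exact Or.inl hb
    refine Or.inr (eq_top_of_rho_mem hb fun A α hα => ?_)
    -- The matrices that send `α` into `I` form a subspace. It contains every `M(x, y)` because
    -- `(VVI) ⊆ I`, so it is all of `𝔤𝔩(7)`.
    let N : Submodule ℂ (Matrix (Fin 7) (Fin 7) ℂ) := I.comap (rho.flip α)
    have : N = ⊤ := eq_top_of_tripleMatrix_mem fun x y => (hI x y α hα).1
    exact this.ge (Submodule.mem_top : A ∈ ⊤)

/-! ### Trivial radical of the Tits-Kantor-Koecher algebra -/

namespace KantorTripleSystem

variable {V : Type*} [AddCommGroup V] [Module ℂ V] (T : KantorTripleSystem V)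

/-- The operator `diag(1, -1)` on `V × V`. -/
def gradingOp (V : Type*) [AddCommGroup V] [Module ℂ V] : Module.End ℂ (V × V) :=
  LinearMap.prodMap LinearMap.id (-LinearMap.id)

theorem gradingOp_apply (t : V × V) : gradingOp V t = (t.1, -t.2) := rfl

theorem gradingOp_mul_self : gradingOp V * gradingOp V = 1 := by
  refine LinearMap.ext fun t => ?_
  simp [gradingOp_apply]

/-- As `J² = 1`, the eigenvalues of `ad J` lie in `{0, 2, -2}`, the roots of `λ³ - 4λ`. -/
theorem gradingOp_lie_lie_lie (X : Module.End ℂ (V × V)) :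
    ⁅gradingOp V, ⁅gradingOp V, ⁅gradingOp V, X⁆⁆⁆ = (4 : ℂ) • ⁅gradingOp V, X⁆ := by
  have h := gradingOp_mul_self (V := V)
  generalize gradingOp V = J at h
  have h' : ∀ Y, J * (J * Y) = Y := fun Y => by rw [← mul_assoc, h, one_mul]
  simp only [Ring.lie_def, mul_sub, sub_mul, mul_assoc, h, h', mul_one]
  module

namespace TKK

variable {T}

/-- An element of `𝔤₋₁ ⊕ 𝔤₁`. -/
def ofOdd : (V × V) →ₗ[ℂ] T.TKK where
  toFun t := ⟨0, t⟩
  map_add' _ _ := TKK.ext (add_zero _).symm rfl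
  map_smul' _ _ := TKK.ext (smul_zero _).symm rfl

/-- An element of `𝔤₋₂ ⊕ 𝔤₀ ⊕ 𝔤₂`. -/
def ofEven : T.evenPart →ₗ[ℂ] T.TKK where
  toFun X := ⟨X, 0⟩
  map_add' _ _ := TKK.ext rfl (add_zero _).symm
  map_smul' _ _ := TKK.ext rfl (smul_zero _).symm

theorem lie_ofEven_ofEven (X Y : T.evenPart) : ⁅ofEven X, ofEven Y⁆ = ofEven ⁅X, Y⁆ := by
  refine TKK.ext (Subtype.ext ?_) ?_
  · rw [lie_even]; simp [ofEven]
  · rw [lie_odd]; simp [ofEven]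

theorem lie_ofEven_ofOdd (X : T.evenPart) (t : V × V) :
    ⁅ofEven X, (ofOdd t : T.TKK)⁆ = ofOdd (X.1 t) := by
  refine TKK.ext (Subtype.ext ?_) ?_
  · rw [lie_even]; simp [ofEven, ofOdd]
  · rw [lie_odd]; simp [ofEven, ofOdd]

theorem lie_ofOdd_ofOdd (t s : V × V) :
    ⁅(ofOdd t : T.TKK), ofOdd s⁆ = ofEven ⟨T.bracketOp t s, T.bracketOp_mem t s⟩ := by
  refine TKK.ext (Subtype.ext ?_) ?_
  · rw [lie_even]; simp [ofEven, ofOdd]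
  · rw [lie_odd]; simp [ofEven, ofOdd]

theorem eq_ofEven_add_ofOdd (x : T.TKK) : x = ofEven x.even + ofOdd x.odd :=
  TKK.ext (add_zero _).symm (zero_add _).symm

theorem ofOdd_injective : Function.Injective (ofOdd : V × V → T.TKK) := fun _ _ h =>
  congrArg TKK.odd h

theorem ofEven_injective : Function.Injective (ofEven : T.evenPart → T.TKK) := fun _ _ h =>
  congrArg TKK.even h

/-- An ideal contains the odd parts of its elements, if the grading element belongs to the
Tits-Kantor-Koecher Lie algebra. -/
theorem ofOdd_mem (hJ : gradingOp V ∈ T.evenPart) (I : LieIdeal ℂ T.TKK) {x : T.TKK}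
    (hx : x ∈ I) : ofOdd x.odd ∈ I ∧ ofOdd (gradingOp V x.odd) ∈ I := by
  let Z : T.TKK := ofEven ⟨gradingOp V, hJ⟩
  -- The polynomial `λ³ - 4λ` in `ad Z` kills the even part. On the odd part, where `λ = ±1`, it
  -- equals `-3λ`.
  have h₁ : ⁅Z, ⁅Z, ⁅Z, x⁆⁆⁆ - (4 : ℂ) • ⁅Z, x⁆ =
      (-3 : ℂ) • (ofOdd (gradingOp V x.odd) : T.TKK) := by
    have h₂ : ⁅Z, ⁅Z, ⁅Z, ofEven x.even⁆⁆⁆ = (4 : ℂ) • ⁅Z, ofEven x.even⁆ := by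
      simp only [Z, lie_ofEven_ofEven, ← map_smul]
      congr 1
      exact Subtype.ext (gradingOp_lie_lie_lie _)
    have h₃ : ⁅Z, ⁅Z, ⁅Z, (ofOdd x.odd : T.TKK)⁆⁆⁆ = ⁅Z, (ofOdd x.odd : T.TKK)⁆ := by
      simp only [Z, lie_ofEven_ofOdd]
      rw [← Module.End.mul_apply (gradingOp V) (gradingOp V), gradingOp_mul_self]
      rfl
    rw [eq_ofEven_add_ofOdd x]
    simp only [lie_add, h₂, h₃, smul_add]
    have h₄ : ⁅Z, (ofOdd x.odd : T.TKK)⁆ = ofOdd (gradingOp V x.odd) := lie_ofEven_ofOdd _ _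
    have h₅ : (ofEven x.even + ofOdd x.odd).odd = x.odd := by rw [← eq_ofEven_add_ofOdd]
    rw [h₄, h₅]
    module
  have h₂ : ofOdd (gradingOp V x.odd) ∈ I := by
    have h₃ : (-3 : ℂ) • ofOdd (gradingOp V x.odd) ∈ I := by
      rw [← h₁]
      exact sub_mem (lie_mem_right _ _ _ _ _ (lie_mem_right _ _ _ _ _ (lie_mem_right _ _ _ _ _ hx)))
        (I.smul_mem _ (lie_mem_right _ _ _ _ _ hx))
    exact (I.toSubmodule.smul_mem_iff (by norm_num)).mp h₃
  refine ⟨?_, h₂⟩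
  have h₃ : ⁅Z, (ofOdd (gradingOp V x.odd) : T.TKK)⁆ ∈ I := lie_mem_right _ _ _ _ _ h₂
  rw [lie_ofEven_ofOdd] at h₃
  change ofOdd ((gradingOp V * gradingOp V) x.odd) ∈ I at h₃
  rwa [gradingOp_mul_self] at h₃

/-- The half sum and half difference with the grading operator are the projections onto `𝔤₋₁` and
`𝔤₁`. -/
theorem fst_mem (hJ : gradingOp V ∈ T.evenPart) (I : LieIdeal ℂ T.TKK) {x : T.TKK}
    (hx : x ∈ I) : ofOdd (x.odd.1, 0) ∈ I ∧ ofOdd (0, x.odd.2) ∈ I := by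
  obtain ⟨h₁, h₂⟩ := ofOdd_mem hJ I hx
  have e₁ : (ofOdd (x.odd.1, 0) : T.TKK) =
      (1 / 2 : ℂ) • (ofOdd x.odd + ofOdd (gradingOp V x.odd)) := by
    rw [← map_add, ← map_smul]
    congr 1
    ext
    · simp only [gradingOp_apply, Prod.smul_fst, Prod.fst_add]; module
    · simp [gradingOp_apply]
  have e₂ : (ofOdd (0, x.odd.2) : T.TKK) =
      (1 / 2 : ℂ) • (ofOdd x.odd - ofOdd (gradingOp V x.odd)) := by
    rw [← map_sub, ← map_smul]
    congr 1
    ext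
    · simp [gradingOp_apply]
    · simp only [gradingOp_apply, Prod.smul_snd, Prod.snd_sub]; module
  rw [e₁, e₂]
  exact ⟨I.smul_mem _ (add_mem h₁ h₂), I.smul_mem _ (sub_mem h₁ h₂)⟩

/-- The Tits-Kantor-Koecher Lie algebra of a `K`-simple Kantor triple system has trivial radical,
if it contains the grading element. -/
theorem hasTrivialRadical_of_isKSimple (hT : T.IsKSimple) (hJ : gradingOp V ∈ T.evenPart) :
    LieAlgebra.HasTrivialRadical ℂ T.TKK := by
  rw [LieAlgebra.hasTrivialRadical_iff_no_abelian_ideals]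
  intro I hI
  have hab : ∀ x ∈ I, ∀ y ∈ I, ⁅x, y⁆ = 0 := fun x hx y hy =>
    congrArg Subtype.val (trivial_lie_zero I I ⟨x, hx⟩ ⟨y, hy⟩)
  obtain ⟨hne, hid⟩ := hT
  have b₁ : ∀ x y z : V, ⁅⁅(ofOdd (x, 0) : T.TKK), ofOdd (0, y)⁆, ofOdd (z, 0)⁆ =
      ofOdd (T.triple x y z, 0) := fun x y z => by
    rw [lie_ofOdd_ofOdd, lie_ofEven_ofOdd]
    congr 1
    simp [bracketOp_apply]
  have b₂ : ∀ x y z : V, ⁅⁅(ofOdd (0, x) : T.TKK), ofOdd (y, 0)⁆, ofOdd (0, z)⁆ =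
      ofOdd (0, T.triple x y z) := fun x y z => by
    rw [lie_ofOdd_ofOdd, lie_ofEven_ofOdd]
    congr 1
    simp [bracketOp_apply]
  -- The intersection of `I` with `𝔤₋₁` is a `K`-ideal. Were it all of `V`, both `[x, σy]` and `z`
  -- would lie in the abelian ideal `I`, and the product would vanish.
  have h₁ : I.toSubmodule.comap (ofOdd ∘ₗ LinearMap.inl ℂ V V) = ⊥ := by
    refine (hid _ fun x y z hz => ?_).resolve_right fun htop => hne ?_
    · replace hz : ofOdd (z, 0) ∈ I := hz
      constructor
      · change ofOdd (T.triple x y z, 0) ∈ I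
        rw [← b₁]
        exact lie_mem_right _ _ _ _ _ hz
      · change ofOdd (T.triple z x y, 0) ∈ I
        rw [← b₁]
        exact lie_mem_left _ _ _ _ _ (lie_mem_left _ _ _ _ _ hz)
    · have hmem : ∀ z : V, ofOdd (z, 0) ∈ I := fun z => htop.ge (Submodule.mem_top : z ∈ ⊤)
      refine LinearMap.ext fun x => LinearMap.ext fun y => LinearMap.ext fun z => ?_
      have h := hab _ (lie_mem_left ℂ _ I _ (ofOdd (0, y)) (hmem x)) _ (hmem z)
      rw [b₁, ← map_zero ofOdd] at h
      exact congrArg Prod.fst (ofOdd_injective h)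
  have h₂ : I.toSubmodule.comap (ofOdd ∘ₗ LinearMap.inr ℂ V V) = ⊥ := by
    refine (hid _ fun x y z hz => ?_).resolve_right fun htop => hne ?_
    · replace hz : ofOdd (0, z) ∈ I := hz
      constructor
      · change ofOdd (0, T.triple x y z) ∈ I
        rw [← b₂]
        exact lie_mem_right _ _ _ _ _ hz
      · change ofOdd (0, T.triple z x y) ∈ I
        rw [← b₂]
        exact lie_mem_left _ _ _ _ _ (lie_mem_left _ _ _ _ _ hz)
    · have hmem : ∀ z : V, ofOdd (0, z) ∈ I := fun z => htop.ge (Submodule.mem_top : z ∈ ⊤)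
      refine LinearMap.ext fun x => LinearMap.ext fun y => LinearMap.ext fun z => ?_
      have h := hab _ (lie_mem_left ℂ _ I _ (ofOdd (y, 0)) (hmem x)) _ (hmem z)
      rw [b₂, ← map_zero ofOdd] at h
      exact congrArg Prod.snd (ofOdd_injective h)
  have hodd : ∀ x ∈ I, x.odd = 0 := fun x hx => by
    obtain ⟨m₁, m₂⟩ := fst_mem hJ I hx
    have e₁ : x.odd.1 ∈ I.toSubmodule.comap (ofOdd ∘ₗ LinearMap.inl ℂ V V) := m₁
    have e₂ : x.odd.2 ∈ I.toSubmodule.comap (ofOdd ∘ₗ LinearMap.inr ℂ V V) := m₂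
    rw [h₁] at e₁
    rw [h₂] at e₂
    exact Prod.ext ((Submodule.mem_bot _).mp e₁) ((Submodule.mem_bot _).mp e₂)
  rw [LieSubmodule.eq_bot_iff]
  intro x hx
  refine TKK.ext (Subtype.ext (LinearMap.ext fun t => ?_)) (hodd x hx)
  -- The bracket of an element of `I` with an odd `t` is again in `I`, so its odd part, the even
  -- part applied to `t`, is zero. The even part acts faithfully.
  have h := hodd _ (lie_mem_left ℂ _ I x (ofOdd t) hx)
  rw [lie_odd] at h
  simpa [ofOdd] using h

instance [FiniteDimensional ℂ V] : FiniteDimensional ℂ T.TKK :=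
  Module.Finite.of_injective
    (⟨⟨toProd, fun _ _ => rfl⟩, fun _ _ => rfl⟩ : T.TKK →ₗ[ℂ] T.evenPart × (V × V))
    toProd_injective

end TKK

end KantorTripleSystem

open KantorTripleSystem KantorTripleSystem.TKK

/-! ### The copy of `𝔤𝔩(7)` in degree zero -/

/-- The component `jbc` of `A · e^{ibc}` is `-A_{ij}` for `i ≠ j`, and minus a sum of three diagonal
entries for `i = j`. If all sums of three distinct diagonal entries vanish, so does each entry. -/
theorem rho_injective : Function.Injective rho := by
  rw [injective_iff_map_eq_zero]
  intro A hA
  have h : ∀ i j b c, i ≠ b → i ≠ c → j ≠ b → j ≠ c → b ≠ c →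
      A i j + kron i j * (A b b + A c c) = 0 := by
    intro i j b c hib hic hjb hjc hbc
    have h₁ : coord (rho A (basisForm i b c)) j b c = 0 := by rw [hA]; rfl
    have s₁ : ∑ n, A n j * coord (basisForm i b c) n b c = A i j := by
      rw [Finset.sum_congr rfl fun n _ => (by
        rw [coord_basisForm, kron_self, kron_self, kron_of_ne hbc, kron_of_ne hib.symm,
          kron_of_ne hic.symm]; ring :
        A n j * coord (basisForm i b c) n b c = kron n i * A n j), sum_kron]
    have s₂ : ∑ n, A n b * coord (basisForm i b c) j n c = kron i j * A b b := by
      rw [Finset.sum_congr rfl fun n _ => (by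
        rw [coord_basisForm, kron_self, kron_of_ne hjb, kron_of_ne hjc, kron_of_ne hbc.symm,
          kron_comm j i]; ring :
        A n b * coord (basisForm i b c) j n c = kron n b * (kron i j * A n b)), sum_kron]
    have s₃ : ∑ n, A n c * coord (basisForm i b c) j b n = kron i j * A c c := by
      rw [Finset.sum_congr rfl fun n _ => (by
        rw [coord_basisForm, kron_self, kron_of_ne hjb, kron_of_ne hjc, kron_of_ne hbc,
          kron_comm j i]; ring :
        A n c * coord (basisForm i b c) j b n = kron n c * (kron i j * A n c)), sum_kron]
    rw [coord_rho, s₁, s₂, s₃] at h₁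
    linear_combination -h₁
  have hd : ∀ i b c, i ≠ b → i ≠ c → b ≠ c → A i i + A b b + A c c = 0 := by
    intro i b c hib hic hbc
    have := h i i b c hib hic hib hic hbc
    rw [kron_self] at this
    linear_combination this
  ext i j
  obtain ⟨b, c, hib, hic, hjb, hjc, hbc⟩ := exists_two_ne i j
  by_cases hij : i = j
  · subst hij
    obtain ⟨d, hid, hbd, hcd⟩ : ∃ d : Fin 7, i ≠ d ∧ b ≠ d ∧ c ≠ d := by
      revert i b c; decide
    have h₁ := hd i b c hib hic hbc
    have h₂ := hd i b d hib hid hbd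
    have h₃ := hd i c d hic hid hcd
    have h₄ := hd b c d hbc hbd hcd
    change A i i = 0
    -- The three sums through `i` add up to `3A_{ii} + 2(A_{bb} + A_{cc} + A_{dd})`; the fourth
    -- removes the rest.
    linear_combination (1 / 3 : ℂ) * (h₁ + h₂ + h₃) - (2 / 3 : ℂ) * h₄
  · have := h i j b c hib hic hjb hjc hbc
    rw [kron_of_ne hij] at this
    change A i j = 0
    linear_combination this

/-- The operator `diag(ρ(A), -ρ(Aᵀ))`. -/
def blockOp : Matrix (Fin 7) (Fin 7) ℂ →ₗ[ℂ] Module.End ℂ (ThreeForm × ThreeForm) where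
  toFun A := LinearMap.prodMap (rho A) (-rho Aᵀ)
  map_add' A B := by
    refine LinearMap.ext fun t => Prod.ext ?_ ?_
    · simp
    · simp [add_comm]
  map_smul' c A := by
    refine LinearMap.ext fun t => Prod.ext ?_ ?_ <;> simp

theorem blockOp_apply (A : Matrix (Fin 7) (Fin 7) ℂ) (t : ThreeForm × ThreeForm) :
    blockOp A t = (rho A t.1, -rho Aᵀ t.2) := rfl

theorem blockOp_lie (A B : Matrix (Fin 7) (Fin 7) ℂ) :
    ⁅blockOp A, blockOp B⁆ = blockOp (A * B - B * A) := by
  refine LinearMap.ext fun t => Prod.ext ?_ ?_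
  · rw [blockOp_apply, rho_lie]
    simp [Ring.lie_def, blockOp_apply]
  · have : (A * B - B * A)ᵀ = -(Aᵀ * Bᵀ - Bᵀ * Aᵀ) := by
      simp [Matrix.transpose_mul]
    rw [blockOp_apply, this, map_neg, rho_lie A B, rho_lie Aᵀ Bᵀ]
    simp only [Ring.lie_def, LinearMap.sub_apply, Module.End.mul_apply, blockOp_apply,
      LinearMap.neg_apply, map_neg, neg_neg, Prod.snd_sub]

theorem bracketOp_formKTS (α β : ThreeForm) :
    formKTS.bracketOp (α, 0) (0, β) = blockOp (tripleMatrix α β) := by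
  refine LinearMap.ext fun t => Prod.ext ?_ ?_
  · simp [bracketOp_apply, blockOp_apply, formKTS_triple, formTriple_eq_rho]
  · simp [bracketOp_apply, blockOp_apply, formKTS_triple, formTriple_eq_rho, ← tripleMatrix_swap]

theorem blockOp_mem (A : Matrix (Fin 7) (Fin 7) ℂ) : blockOp A ∈ formKTS.evenPart := by
  have : formKTS.evenPart.toSubmodule.comap blockOp = ⊤ :=
    eq_top_of_tripleMatrix_mem fun α β => by
      change blockOp (tripleMatrix α β) ∈ formKTS.evenPart
      rw [← bracketOp_formKTS]
      exact bracketOp_mem _ _ _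
  exact this.ge (Submodule.mem_top : A ∈ ⊤)

theorem gradingOp_mem : gradingOp ThreeForm ∈ formKTS.evenPart := by
  -- The constant is forced by `ρ(1) = -3`.
  have : gradingOp ThreeForm = blockOp (-(1 / 3 : ℂ) • 1) := by
    refine LinearMap.ext fun t => Prod.ext ?_ ?_
    · simp [gradingOp_apply, blockOp_apply, rho_one]
    · simp [gradingOp_apply, blockOp_apply, rho_one]
  rw [this]
  exact blockOp_mem _

instance : FiniteDimensional ℂ ThreeForm :=
  Module.Finite.of_injective
    (⟨⟨coord, fun _ _ => rfl⟩, fun _ _ => rfl⟩ :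
      ThreeForm →ₗ[ℂ] (Fin 7 → Fin 7 → Fin 7 → ℂ))
    fun _ _ h => ext_coord fun a b c => congrFun (congrFun (congrFun h a) b) c

instance : LieAlgebra.HasTrivialRadical ℂ formKTS.TKK :=
  hasTrivialRadical_of_isKSimple formKTS_isKSimple gradingOp_mem

/-- The embedding of `𝔤𝔩(7)` into the Tits-Kantor-Koecher Lie algebra. -/
def ofMatrix : Matrix (Fin 7) (Fin 7) ℂ →ₗ[ℂ] formKTS.TKK :=
  ofEven ∘ₗ blockOp.codRestrict formKTS.evenPart.toSubmodule blockOp_mem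

theorem ofMatrix_lie (A B : Matrix (Fin 7) (Fin 7) ℂ) :
    ⁅ofMatrix A, ofMatrix B⁆ = ofMatrix (A * B - B * A) := by
  refine (lie_ofEven_ofEven _ _).trans (congrArg ofEven (Subtype.ext ?_))
  exact blockOp_lie A B

theorem ofMatrix_lie_ofOdd (A : Matrix (Fin 7) (Fin 7) ℂ) (α β : ThreeForm) :
    ⁅ofMatrix A, (ofOdd (α, β) : formKTS.TKK)⁆ = ofOdd (rho A α, -rho Aᵀ β) :=
  lie_ofEven_ofOdd _ _

theorem ofOdd_lie_ofOdd (α β : ThreeForm) :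
    ⁅(ofOdd (α, 0) : formKTS.TKK), (ofOdd (0, β) : formKTS.TKK)⁆ =
      ofMatrix (tripleMatrix α β) :=
  (lie_ofOdd_ofOdd _ _).trans (congrArg ofEven (Subtype.ext (bracketOp_formKTS α β)))

theorem ofMatrix_injective : Function.Injective ofMatrix := by
  intro A B h
  have h₁ : blockOp A = blockOp B := congrArg Subtype.val (ofEven_injective h)
  exact rho_injective (LinearMap.ext fun α => congrArg Prod.fst (LinearMap.congr_fun h₁ (α, 0)))

/-! ### Chevalley generators of type `E₇` -/

/-- Three times the diagonal entries of the simple coroots of `E₇`. -/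
def corootInt : Option (Fin 6) → Fin 7 → ℤ
  | none => fun k => if k = 0 ∨ k = 1 ∨ k = 2 then -2 else 1
  | some i => fun k => if k = i.castSucc then 3 else if k = i.succ then -3 else 0

/-- The diagonal entries of the simple coroots of `E₇`. -/
def corootVec (i : Option (Fin 6)) (k : Fin 7) : ℂ := (1 / 3) * corootInt i k

/-- The simple roots of `E₇` as functions of a diagonal matrix. -/
def simpleRoot {R : Type*} [Ring R] : Option (Fin 6) → (Fin 7 → R) → R
  | none, d => -(d 0 + d 1 + d 2)
  | some i, d => d i.castSucc - d i.succ

/-- The Cartan matrix `E₇`, with rows and columns indexed by `Option (Fin 6)`. -/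
def cartanE₇ : Matrix (Option (Fin 6)) (Option (Fin 6)) ℤ :=
  CartanMatrix.E₇.reindex (finSuccEquiv' 1) (finSuccEquiv' 1)

/-- The factor `3` makes the coroots integral, so that the pairing is decidable. In `cartanE₇`,
`none` is the branch node, joined to the third node `some 2` of the chain. -/
theorem simpleRoot_corootInt : ∀ i j, simpleRoot i (corootInt j) = 3 * cartanE₇ i j := by
  decide

theorem simpleRoot_corootVec (i j : Option (Fin 6)) :
    simpleRoot i (corootVec j) = cartanE₇ i j := by
  have h := congrArg (Int.cast (R := ℂ)) (simpleRoot_corootInt i j)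
  have e : ((simpleRoot i (corootInt j) : ℤ) : ℂ) = 3 * simpleRoot i (corootVec j) := by
    rcases i with _ | i <;> simp [simpleRoot, corootVec] <;> ring
  rw [e] at h
  push_cast at h
  linear_combination (1 / 3 : ℂ) * h

theorem cartanE₇_nondegenerate : cartanE₇.Nondegenerate := by
  -- The second factor is twice the inverse of the Cartan matrix, the least multiple that is
  -- integral.
  have h : CartanMatrix.E₇ * !![4, 4, 6, 8, 6, 4, 2; 4, 7, 8, 12, 9, 6, 3; 6, 8, 12, 16, 12, 8, 4;
      8, 12, 16, 24, 18, 12, 6; 6, 9, 12, 18, 15, 10, 5; 4, 6, 8, 12, 10, 8, 4;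
      2, 3, 4, 6, 5, 4, 3] = (2 : ℤ) • 1 := by decide
  rw [Matrix.nondegenerate_iff_det_ne_zero, cartanE₇, Matrix.reindex_apply,
    Matrix.det_submatrix_equiv_self]
  intro h₀
  have := congrArg Matrix.det h
  rw [Matrix.det_mul, h₀, zero_mul, Matrix.det_smul, Matrix.det_one] at this
  norm_num at this

def chevalleyH (i : Option (Fin 6)) : formKTS.TKK := ofMatrix (Matrix.diagonal (corootVec i))

def chevalleyE : Option (Fin 6) → formKTS.TKK
  | none => ofOdd (basisForm 0 1 2, 0)
  | some i => ofMatrix (Matrix.single i.castSucc i.succ 1)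

def chevalleyF : Option (Fin 6) → formKTS.TKK
  | none => ofOdd (0, basisForm 0 1 2)
  | some i => ofMatrix (Matrix.single i.succ i.castSucc 1)

theorem ofMatrix_single_lie_single {i j k : Fin 7} (h : i ≠ k) :
    ⁅ofMatrix (Matrix.single i j 1), ofMatrix (Matrix.single j k 1)⁆ =
      ofMatrix (Matrix.single i k 1) := by
  rw [ofMatrix_lie, Matrix.single_mul_single_same, Matrix.single_mul_single_of_ne _ _ _ _ h.symm,
    sub_zero, one_mul]

theorem ofMatrix_single_lie_single_of_ne {i j k l : Fin 7} (h : j ≠ k) (h' : l ≠ i) :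
    ⁅ofMatrix (Matrix.single i j 1), ofMatrix (Matrix.single k l 1)⁆ = 0 := by
  rw [ofMatrix_lie, Matrix.single_mul_single_of_ne _ _ _ _ h,
    Matrix.single_mul_single_of_ne _ _ _ _ h', sub_zero, map_zero]

theorem ofMatrix_single_lie_single_swap (i j : Fin 7) :
    ⁅ofMatrix (Matrix.single i j 1), ofMatrix (Matrix.single j i 1)⁆ =
      ofMatrix (Matrix.single i i 1 - Matrix.single j j 1) := by
  rw [ofMatrix_lie, Matrix.single_mul_single_same, Matrix.single_mul_single_same, one_mul]

theorem diagonal_corootVec_none : Matrix.diagonal (corootVec none) = (1 / 3 : ℂ) • 1 -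
    (Matrix.single 0 0 1 + Matrix.single 1 1 1 + Matrix.single 2 2 1) := by
  ext i j
  by_cases hij : i = j
  · subst hij
    have h : ∀ i : Fin 7, corootInt none i =
        1 - 3 * ((if i = 0 then 1 else 0) + (if i = 1 then 1 else 0) + if i = 2 then 1 else 0) := by
      decide
    have e : ∀ k, Matrix.single k k (1 : ℂ) i i = if i = k then 1 else 0 := fun k => by
      simp [Matrix.single_apply, eq_comm]
    simp only [Matrix.diagonal_apply_eq, corootVec, h, Matrix.sub_apply, Matrix.add_apply,
      Matrix.smul_apply, Matrix.one_apply_eq, e, smul_eq_mul]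
    push_cast
    ring
  · have : ∀ k : Fin 7, ¬ (k = i ∧ k = j) := fun k hk => hij (hk.1.symm.trans hk.2)
    simp [Matrix.diagonal_apply_ne _ hij, Matrix.one_apply_ne hij, this]

theorem diagonal_corootVec_some (i : Fin 6) : Matrix.diagonal (corootVec (some i)) =
    Matrix.single i.castSucc i.castSucc 1 - Matrix.single i.succ i.succ 1 := by
  have hne : i.castSucc ≠ i.succ := Fin.castSucc_lt_succ.ne
  ext a b
  by_cases hab : a = b
  · subst hab
    simp only [Matrix.diagonal_apply_eq, corootVec, corootInt, Matrix.sub_apply,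
      Matrix.single_apply, and_self, eq_comm (b := a)]
    split_ifs <;> simp_all
  · have : ∀ k : Fin 7, ¬ (k = a ∧ k = b) := fun k hk => hab (hk.1.symm.trans hk.2)
    simp [Matrix.diagonal_apply_ne _ hab, this]

theorem rho_diagonal_basisForm (d : Fin 7 → ℂ) (a b c : Fin 7) :
    rho (Matrix.diagonal d) (basisForm a b c) = -(d a + d b + d c) • basisForm a b c := by
  have h : ∀ (m : Fin 7) (f : Fin 7 → ℂ), ∑ n, Matrix.diagonal d n m * f n = d m * f m := by
    intro m f
    rw [Finset.sum_eq_single m (fun n _ hn => by rw [Matrix.diagonal_apply_ne _ hn, zero_mul])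
      (by simp), Matrix.diagonal_apply_eq]
  have h' : ∀ x y, d x * kron x y = d y * kron x y := fun x y => by
    by_cases hxy : x = y
    · rw [hxy]
    · rw [kron_of_ne hxy, mul_zero, mul_zero]
  refine ext_coord fun p q r => ?_
  rw [coord_rho, h p fun n => coord _ n q r, h q fun n => coord _ p n r,
    h r fun n => coord _ p q n]
  simp only [coord_smul, coord_basisForm]
  linear_combination (-(kron q b * kron r c - kron q c * kron r b)) * h' p a
    - (kron q c * kron r a - kron q a * kron r c) * h' p b
    - (kron q a * kron r b - kron q b * kron r a) * h' p c
    - (kron p c * kron r b - kron p b * kron r c) * h' q a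
    - (kron p a * kron r c - kron p c * kron r a) * h' q b
    - (kron p b * kron r a - kron p a * kron r b) * h' q c
    - (kron p b * kron q c - kron p c * kron q b) * h' r a
    - (kron p c * kron q a - kron p a * kron q c) * h' r b
    - (kron p a * kron q b - kron p b * kron q a) * h' r c

theorem diagonal_commutator_single (d : Fin 7 → ℂ) (i j : Fin 7) :
    Matrix.diagonal d * Matrix.single i j 1 - Matrix.single i j 1 * Matrix.diagonal d =
      (d i - d j) • Matrix.single i j 1 := by
  ext a b
  rw [Matrix.sub_apply, Matrix.diagonal_mul, Matrix.mul_diagonal, Matrix.smul_apply,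
    Matrix.single_apply, smul_eq_mul]
  split_ifs with h
  · rw [h.1, h.2]; ring
  · ring

theorem lie_chevalleyE (d : Fin 7 → ℂ) (i : Option (Fin 6)) :
    ⁅ofMatrix (Matrix.diagonal d), chevalleyE i⁆ = simpleRoot i d • chevalleyE i := by
  rcases i with _ | i
  · rw [chevalleyE, ofMatrix_lie_ofOdd, rho_diagonal_basisForm, ← map_smul]
    simp [simpleRoot]
  · rw [chevalleyE, ofMatrix_lie, ← map_smul]
    rw [diagonal_commutator_single, simpleRoot]

theorem lie_chevalleyF (d : Fin 7 → ℂ) (i : Option (Fin 6)) :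
    ⁅ofMatrix (Matrix.diagonal d), chevalleyF i⁆ = -simpleRoot i d • chevalleyF i := by
  rcases i with _ | i
  · rw [chevalleyF, ofMatrix_lie_ofOdd, Matrix.diagonal_transpose, rho_diagonal_basisForm,
      ← map_smul, map_zero, Prod.smul_mk, smul_zero, simpleRoot, neg_smul, neg_neg, neg_neg]
  · rw [chevalleyF, ofMatrix_lie, ← map_smul]
    rw [diagonal_commutator_single, simpleRoot, neg_sub]

theorem chevalleyE_lie_chevalleyF (i : Option (Fin 6)) :
    ⁅chevalleyE i, chevalleyF i⁆ = chevalleyH i := by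
  rcases i with _ | i
  · rw [chevalleyE, chevalleyF, chevalleyH, ofOdd_lie_ofOdd, diagonal_corootVec_none,
      tripleMatrix_basisForm_self (by decide) (by decide) (by decide)]
  · rw [chevalleyE, chevalleyF, chevalleyH, ofMatrix_single_lie_single_swap,
      diagonal_corootVec_some]

/-- The matrix unit replaces an index by its predecessor. In `e^{012}` this either repeats an index
or is impossible. With its transpose, the lemma covers both mixed relations between the branch node
and the chain. -/
theorem rho_single_basisForm_eq_zero (i : Fin 6) :
    rho (Matrix.single i.succ i.castSucc 1) (basisForm 0 1 2) = 0 := by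
  have h₁ : ∀ i : Fin 6, (0 : Fin 7) ≠ i.succ := by decide
  rw [rho_single_basisForm, kron_comm, kron_of_ne (h₁ i)]
  have h₂ : kron i.succ 1 • basisForm 0 i.castSucc 2 = 0 := by
    by_cases h : i.succ = (1 : Fin 7)
    · have : i.castSucc = 0 := by revert i; decide
      rw [this, basisForm_eq_zero (Or.inl rfl), smul_zero]
    · rw [kron_of_ne h, zero_smul]
  have h₃ : kron i.succ 2 • basisForm 0 1 i.castSucc = 0 := by
    by_cases h : i.succ = (2 : Fin 7)
    · have : i.castSucc = 1 := by clear h₂; revert i; decide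
      rw [this, basisForm_eq_zero (Or.inr (Or.inr rfl)), smul_zero]
    · rw [kron_of_ne h, zero_smul]
  rw [h₂, h₃]
  simp

theorem chevalleyE_lie_chevalleyF_of_ne {i j : Option (Fin 6)} (hij : i ≠ j) :
    ⁅chevalleyE i, chevalleyF j⁆ = 0 := by
  rcases i with _ | i <;> rcases j with _ | j
  · exact absurd rfl hij
  · rw [chevalleyE, chevalleyF, ← lie_skew, ofMatrix_lie_ofOdd, rho_single_basisForm_eq_zero,
      map_zero, neg_zero, Prod.mk_zero_zero, map_zero, neg_zero]
  · rw [chevalleyE, chevalleyF, ofMatrix_lie_ofOdd, Matrix.transpose_single,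
      rho_single_basisForm_eq_zero, map_zero, neg_zero, Prod.mk_zero_zero, map_zero]
  · have h : i ≠ j := fun e => hij (congrArg some e)
    rw [chevalleyE, chevalleyF, ofMatrix_single_lie_single_of_ne]
    · exact fun e => h (Fin.succ_injective _ e)
    · exact fun e => h (Fin.castSucc_injective _ e).symm

theorem lie_chevalleyH_chevalleyH (i j : Option (Fin 6)) :
    ⁅chevalleyH i, chevalleyH j⁆ = 0 := by
  rw [chevalleyH, chevalleyH, ofMatrix_lie, Matrix.diagonal_mul_diagonal,
    Matrix.diagonal_mul_diagonal]
  simp [mul_comm]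

/-- A Lie subalgebra containing the odd part is everything. -/
theorem KantorTripleSystem.TKK.eq_top_of_ofOdd_mem {V : Type*} [AddCommGroup V] [Module ℂ V]
    {T : KantorTripleSystem V} {S : LieSubalgebra ℂ T.TKK} (h : ∀ t : V × V, ofOdd t ∈ S) :
    S = ⊤ := by
  have heven : ∀ X : T.evenPart, ofEven X ∈ S := by
    have hle : Submodule.span ℂ {A | ∃ t s : V × V, T.bracketOp t s = A} ≤
        (S.toSubmodule.comap ofEven).map T.evenPart.toSubmodule.subtype := by
      rw [Submodule.span_le]
      rintro _ ⟨t, s, rfl⟩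
      refine ⟨⟨_, T.bracketOp_mem t s⟩, ?_, rfl⟩
      change ofEven _ ∈ S
      rw [← lie_ofOdd_ofOdd]
      exact S.lie_mem (h t) (h s)
    rintro ⟨X, hX⟩
    obtain ⟨Y, hY, rfl⟩ := hle hX
    exact hY
  refine eq_top_iff.mpr fun x _ => ?_
  rw [eq_ofEven_add_ofOdd x]
  exact S.add_mem (heven _) (h _)

theorem ofMatrix_mem_of_chevalley_mem {S : LieSubalgebra ℂ formKTS.TKK}
    (hE : ∀ i, chevalleyE i ∈ S) (hF : ∀ i, chevalleyF i ∈ S) (A : Matrix (Fin 7) (Fin 7) ℂ) :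
    ofMatrix A ∈ S := by
  -- Induction on the distance `n + 1` from the diagonal, using `[E_{im}, E_{mj}] = E_{ij}` with `m`
  -- adjacent to `j`.
  have h₁ : ∀ n : ℕ, ∀ i j : Fin 7, i.val + n + 1 = j.val →
      ofMatrix (Matrix.single i j 1) ∈ S ∧ ofMatrix (Matrix.single j i 1) ∈ S := by
    intro n
    induction n with
    | zero =>
      intro i j hij
      obtain ⟨m, rfl, rfl⟩ : ∃ m : Fin 6, i = m.castSucc ∧ j = m.succ :=
        ⟨⟨i, by omega⟩, Fin.ext rfl, Fin.ext (by simp; omega)⟩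
      exact ⟨hE (some m), hF (some m)⟩
    | succ n ih =>
      intro i j hij
      obtain ⟨h₁, h₂⟩ := ih i ⟨i + n + 1, by omega⟩ rfl
      obtain ⟨m, hm, rfl⟩ : ∃ m : Fin 6, ⟨i + n + 1, by omega⟩ = m.castSucc ∧ j = m.succ :=
        ⟨⟨i + n + 1, by omega⟩, Fin.ext rfl, Fin.ext (by simp; omega)⟩
      rw [hm] at h₁ h₂
      have hne : i ≠ m.succ := by rintro rfl; omega
      rw [← ofMatrix_single_lie_single (j := m.castSucc) hne,
        ← ofMatrix_single_lie_single (j := m.castSucc) hne.symm]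
      exact ⟨S.lie_mem h₁ (hE (some m)), S.lie_mem (hF (some m)) h₂⟩
  have h₂ : ∀ i j, i ≠ j → ofMatrix (Matrix.single i j 1) ∈ S := by
    intro i j hij
    rcases lt_or_gt_of_ne hij with h | h
    · exact (h₁ (j - i - 1) i j (by omega)).1
    · exact (h₁ (i - j - 1) j i (by omega)).2
  have h₃ : S.toSubmodule.comap ofMatrix = ⊤ := by
    refine eq_top_of_single_mem (a := 0) (b := 1) (c := 2) h₂ (fun i j => ?_) ?_
    · by_cases hij : i = j
      · rw [hij, sub_self]
        exact zero_mem _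
      · change ofMatrix _ ∈ S
        rw [← ofMatrix_single_lie_single_swap]
        exact S.lie_mem (h₂ i j hij) (h₂ j i (Ne.symm hij))
    -- The chain alone generates only traceless matrices; the coroot of the branch node, of trace
    -- `-2/3`, supplies the scalars.
    · rw [← diagonal_corootVec_none]
      change chevalleyH none ∈ S
      rw [← chevalleyE_lie_chevalleyF]
      exact S.lie_mem (hE none) (hF none)
  exact h₃.ge (Submodule.mem_top : A ∈ ⊤)

theorem basisForm_ne_zero {a b c : Fin 7} (hab : a ≠ b) (hac : a ≠ c) (hbc : b ≠ c) :
    basisForm a b c ≠ 0 := by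
  intro h
  have h₁ : coord (basisForm a b c) a b c = 0 := by rw [h]; rfl
  simp [coord_basisForm, kron_self, kron_of_ne hab, kron_of_ne hac, kron_of_ne hbc,
    kron_of_ne hbc.symm] at h₁

/-- The generators yield all of `𝔤𝔩(7)`. By irreducibility, `e^{012}` in degrees `-1` and `1` then
yields the whole odd part, and the odd part generates `𝔤`. -/
theorem lieSpan_chevalley :
    LieSubalgebra.lieSpan ℂ formKTS.TKK (Set.range chevalleyE ∪ Set.range chevalleyF) = ⊤ := by
  set S := LieSubalgebra.lieSpan ℂ formKTS.TKK (Set.range chevalleyE ∪ Set.range chevalleyF)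
  have hE : ∀ i, chevalleyE i ∈ S := fun i => LieSubalgebra.subset_lieSpan (Or.inl ⟨i, rfl⟩)
  have hF : ∀ i, chevalleyF i ∈ S := fun i => LieSubalgebra.subset_lieSpan (Or.inr ⟨i, rfl⟩)
  have hM := ofMatrix_mem_of_chevalley_mem hE hF
  have hne : basisForm 0 1 2 ≠ 0 := basisForm_ne_zero (by decide) (by decide) (by decide)
  have h₁ : S.toSubmodule.comap (ofOdd ∘ₗ LinearMap.inl ℂ ThreeForm ThreeForm) = ⊤ := by
    refine eq_top_of_rho_mem (Submodule.ne_bot_iff _ |>.mpr ⟨_, hE none, hne⟩) fun A α hα => ?_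
    have := S.lie_mem (hM A) hα
    rw [LinearMap.comp_apply, LinearMap.inl_apply, ofMatrix_lie_ofOdd, map_zero, neg_zero] at this
    exact this
  have h₂ : S.toSubmodule.comap (ofOdd ∘ₗ LinearMap.inr ℂ ThreeForm ThreeForm) = ⊤ := by
    refine eq_top_of_rho_mem (Submodule.ne_bot_iff _ |>.mpr ⟨_, hF none, hne⟩) fun A α hα => ?_
    have := S.lie_mem (hM (-Aᵀ)) hα
    rw [LinearMap.comp_apply, LinearMap.inr_apply, ofMatrix_lie_ofOdd, map_zero,
      Matrix.transpose_neg, Matrix.transpose_transpose, map_neg, LinearMap.neg_apply,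
      neg_neg] at this
    exact this
  refine eq_top_of_ofOdd_mem fun t => ?_
  have e : t = LinearMap.inl ℂ ThreeForm ThreeForm t.1 +
      LinearMap.inr ℂ ThreeForm ThreeForm t.2 := by
    simp
  rw [e, map_add]
  exact S.add_mem (h₁.ge (Submodule.mem_top : t.1 ∈ ⊤)) (h₂.ge (Submodule.mem_top : t.2 ∈ ⊤))

theorem chevalleyE_ne_zero (i : Option (Fin 6)) : chevalleyE i ≠ 0 := by
  rcases i with _ | i
  · rw [chevalleyE, ← map_zero ofOdd]
    exact fun h => basisForm_ne_zero (by decide) (by decide) (by decide)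
      (congrArg Prod.fst (ofOdd_injective h))
  · rw [chevalleyE, ← map_zero ofMatrix]
    intro h
    have := congrFun (congrFun (ofMatrix_injective h) i.castSucc) i.succ
    simp at this

theorem chevalleyH_lie_chevalleyE (i j : Option (Fin 6)) :
    ⁅chevalleyH j, chevalleyE i⁆ = cartanE₇ i j • chevalleyE i := by
  rw [chevalleyH, lie_chevalleyE, simpleRoot_corootVec, Int.cast_smul_eq_zsmul]

theorem chevalleyH_lie_chevalleyF (i j : Option (Fin 6)) :
    ⁅chevalleyH j, chevalleyF i⁆ = -cartanE₇ i j • chevalleyF i := by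
  rw [chevalleyH, lie_chevalleyF, simpleRoot_corootVec, ← Int.cast_neg, Int.cast_smul_eq_zsmul]

/-- A linear relation, bracketed with each `E_i`, puts its coefficients in the kernel of the
invertible Cartan matrix. -/
theorem linearIndependent_chevalleyH : LinearIndependent ℂ chevalleyH := by
  rw [Fintype.linearIndependent_iff]
  intro c hc
  have h : (cartanE₇.map (Int.cast : ℤ → ℂ)) *ᵥ c = 0 := by
    funext i
    have h₁ : ⁅∑ j, c j • chevalleyH j, chevalleyE i⁆ = 0 := by rw [hc, zero_lie]
    rw [sum_lie] at h₁
    simp only [smul_lie, chevalleyH_lie_chevalleyE, ← Int.cast_smul_eq_zsmul ℂ, smul_smul] at h₁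
    rw [← Finset.sum_smul, smul_eq_zero, or_iff_left (chevalleyE_ne_zero i)] at h₁
    simpa [Matrix.mulVec, dotProduct, mul_comm] using h₁
  have hdet : (cartanE₇.map (Int.cast : ℤ → ℂ)).det ≠ 0 := by
    have := Matrix.nondegenerate_iff_det_ne_zero.mp cartanE₇_nondegenerate
    change ((Int.castRingHom ℂ).mapMatrix cartanE₇).det ≠ 0
    rw [← RingHom.map_det]
    simpa using this
  exact congrFun (Matrix.eq_zero_of_mulVec_eq_zero hdet h)

theorem isSl2Triple_chevalley (i : Option (Fin 6)) :
    IsSl2Triple (chevalleyH i) (chevalleyE i) (chevalleyF i) where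
  h_ne_zero := linearIndependent_chevalleyH.ne_zero i
  lie_e_f := chevalleyE_lie_chevalleyF i
  lie_h_e_nsmul := by
    have : cartanE₇ i i = 2 := by revert i; decide
    rw [chevalleyH_lie_chevalleyE, this, ofNat_zsmul]
  lie_h_f_nsmul := by
    have : cartanE₇ i i = 2 := by revert i; decide
    rw [chevalleyH_lie_chevalleyF, this, neg_smul, ofNat_zsmul]

/-- The Chevalley generators of the Tits-Kantor-Koecher Lie algebra of `formKTS`. -/
def chevalleyBasis : LieAlgebra.Basis (Option (Fin 6))
    (LieSubalgebra.lieSpan ℂ formKTS.TKK (Set.range chevalleyH)) where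
  A := cartanE₇
  h := chevalleyH
  e := chevalleyE
  f := chevalleyF
  cartan_eq_lieSpan := rfl
  span_ef := lieSpan_chevalley
  linInd := linearIndependent_chevalleyH
  nondegen := cartanE₇_nondegenerate
  sl2 := isSl2Triple_chevalley
  lie_h_h := lie_chevalleyH_chevalleyH
  lie_h_e := chevalleyH_lie_chevalleyE
  lie_h_f := chevalleyH_lie_chevalleyF
  lie_e_f_ne _ _ := chevalleyE_lie_chevalleyF_of_ne

/-- Trivial radical gives a nondegenerate Killing form in characteristic zero, and the Chevalley
generators give the Cartan subalgebra and the base. What remains is undoing the renumbering in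
`cartanE₇`. -/
theorem isTypeE7_formKTS : IsTypeE7 formKTS.TKK := by
  refine ⟨inferInstance, inferInstance, _, chevalleyBasis.isCartanSubalgebra, chevalleyBasis.base,
    chevalleyBasis.baseSupportEquiv.symm.trans (finSuccEquiv' 1).symm, ?_⟩
  have h : ∀ {κ : Type} (σ : Option (Fin 6) ≃ κ), (cartanE₇.reindex σ σ).reindex
      (σ.symm.trans (finSuccEquiv' 1).symm) (σ.symm.trans (finSuccEquiv' 1).symm) =
      CartanMatrix.E₇ := fun σ => by
    ext i j
    simp [cartanE₇]
  rw [chevalleyBasis.cartanMatrix_base_eq]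
  exact h _

/-! ### Derivations and the stabilizer of `η` -/

namespace KantorTripleSystem

variable {V : Type*} [AddCommGroup V] [Module ℂ V] {T : KantorTripleSystem V}

theorem prodMap_lie_bracketOp {δ : Module.End ℂ V} (hδ : δ ∈ T.der) (t s : V × V) :
    ⁅δ.prodMap δ, T.bracketOp t s⁆ =
      T.bracketOp (δ.prodMap δ t) s + T.bracketOp t (δ.prodMap δ s) := by
  replace hδ : ∀ x y z : V, δ (T.triple x y z) =
    T.triple (δ x) y z + T.triple x (δ y) z + T.triple x y (δ z) := hδ
  refine LinearMap.ext fun r => Prod.ext ?_ ?_ <;>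
  · simp only [Ring.lie_def, LinearMap.sub_apply, Module.End.mul_apply, LinearMap.add_apply,
      bracketOp_apply, LinearMap.prodMap_apply, kantorTensor_apply, map_add, map_sub, hδ,
      Prod.fst_sub, Prod.snd_sub, Prod.fst_add, Prod.snd_add]
    abel

theorem prodMap_lie_mem {δ : Module.End ℂ V} (hδ : δ ∈ T.der) {X : Module.End ℂ (V × V)}
    (hX : X ∈ T.evenPart) : ⁅δ.prodMap δ, X⁆ ∈ T.evenPart := by
  change X ∈ Submodule.span ℂ {A | ∃ t s : V × V, T.bracketOp t s = A} at hX
  induction hX using Submodule.span_induction with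
  | mem X hX =>
    obtain ⟨t, s, rfl⟩ := hX
    rw [prodMap_lie_bracketOp hδ]
    exact add_mem (T.bracketOp_mem _ _) (T.bracketOp_mem _ _)
  | zero => rw [lie_zero]; exact zero_mem _
  | add X Y _ _ h₁ h₂ => rw [lie_add]; exact add_mem h₁ h₂
  | smul c X _ h => rw [lie_smul]; exact T.evenPart.smul_mem c h

namespace TKK

/-- The extension of a derivation of a Kantor triple system to its Tits-Kantor-Koecher Lie
algebra. -/
def derivation (δ : T.der) : LieDerivation ℂ T.TKK T.TKK where
  toFun x := ⟨⟨⁅δ.1.prodMap δ.1, x.even.1⁆, prodMap_lie_mem δ.2 x.even.2⟩, δ.1.prodMap δ.1 x.odd⟩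
  map_add' x y := TKK.ext (Subtype.ext (lie_add _ x.even.1 y.even.1)) (map_add _ x.odd y.odd)
  map_smul' c x := TKK.ext (Subtype.ext (lie_smul c _ x.even.1)) (map_smul _ c x.odd)
  leibniz' := by
    rintro ⟨⟨A, hA⟩, t⟩ ⟨⟨B, hB⟩, s⟩
    refine TKK.ext (Subtype.ext ?_) ?_
    · change ⁅δ.1.prodMap δ.1, ⁅A, B⁆ + T.bracketOp t s⁆ =
        (⁅A, ⁅δ.1.prodMap δ.1, B⁆⁆ + T.bracketOp t (δ.1.prodMap δ.1 s)) -
          (⁅B, ⁅δ.1.prodMap δ.1, A⁆⁆ + T.bracketOp s (δ.1.prodMap δ.1 t))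
      rw [lie_add, leibniz_lie, prodMap_lie_bracketOp δ.2, T.bracketOp_skew s,
        ← lie_skew B ⁅δ.1.prodMap δ.1, A⁆]
      abel
    · change δ.1.prodMap δ.1 (A s - B t) =
        (A (δ.1.prodMap δ.1 s) - ⁅δ.1.prodMap δ.1, B⁆ t) -
          (B (δ.1.prodMap δ.1 t) - ⁅δ.1.prodMap δ.1, A⁆ s)
      simp only [Ring.lie_def, LinearMap.sub_apply, Module.End.mul_apply, map_sub]
      abel

/-- The extension of `δ` to `𝔤` is inner, equal to `ad x`. Comparing odd parts on odd elements
identifies the even part of `x` with `diag(δ, δ)`. -/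
theorem prodMap_mem_evenPart [FiniteDimensional ℂ V] [LieAlgebra.IsKilling ℂ T.TKK]
    {δ : Module.End ℂ V} (hδ : δ ∈ T.der) : δ.prodMap δ ∈ T.evenPart := by
  obtain ⟨x, hx⟩ := LieDerivation.IsKilling.exists_eq_ad (derivation ⟨δ, hδ⟩)
  have h : x.even.1 = δ.prodMap δ := LinearMap.ext fun t => by
    have h₁ := congrArg (fun D : LieDerivation ℂ T.TKK T.TKK => (D (ofOdd t)).odd) hx
    rw [LieDerivation.ad_apply_apply, lie_odd] at h₁
    change _ = δ.prodMap δ t at h₁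
    simpa [ofOdd] using h₁
  rw [← h]
  exact x.even.2

end TKK

end KantorTripleSystem

/-- Only the diagonal blocks are constrained; the off-diagonal ones belong to `𝔤₋₂` and `𝔤₂`. -/
theorem exists_blocks_of_mem_evenPart {X : Module.End ℂ (ThreeForm × ThreeForm)}
    (hX : X ∈ formKTS.evenPart) : ∃ A : Matrix (Fin 7) (Fin 7) ℂ,
      ∀ α, (X (α, 0)).1 = rho A α ∧ (X (0, α)).2 = -rho Aᵀ α := by
  change X ∈ Submodule.span ℂ {A | ∃ t s, formKTS.bracketOp t s = A} at hX
  induction hX using Submodule.span_induction with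
  | mem X hX =>
    obtain ⟨t, s, rfl⟩ := hX
    refine ⟨tripleMatrix t.1 s.2 - tripleMatrix s.1 t.2, fun α => ⟨?_, ?_⟩⟩
    · simp [bracketOp_apply, formKTS_triple, formTriple_eq_rho]
    · simp [bracketOp_apply, formKTS_triple, formTriple_eq_rho, ← tripleMatrix_swap]
  | zero => exact ⟨0, fun α => by simp⟩
  | add X Y _ _ h₁ h₂ =>
    obtain ⟨A, hA⟩ := h₁
    obtain ⟨B, hB⟩ := h₂
    refine ⟨A + B, fun α => ⟨?_, ?_⟩⟩
    · simp [hA, hB]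
    · simp [hA, hB, add_comm]
  | smul c X _ h =>
    obtain ⟨A, hA⟩ := h
    exact ⟨c • A, fun α => by simp [hA]⟩

/-- The two diagonal blocks of `diag(δ, δ)` give `ρ(A) = δ = -ρ(Aᵀ)`, and `ρ` is injective. -/
theorem exists_rho_eq_of_mem_der {δ : Module.End ℂ ThreeForm} (hδ : δ ∈ formKTS.der) :
    ∃ A : Matrix (Fin 7) (Fin 7) ℂ, Aᵀ = -A ∧ rho A = δ := by
  obtain ⟨A, hA⟩ := exists_blocks_of_mem_evenPart (prodMap_mem_evenPart hδ)
  have h₁ : rho A = δ := LinearMap.ext fun α => (hA α).1.symm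
  have h₂ : rho (-Aᵀ) = δ := LinearMap.ext fun α => by
    rw [map_neg]
    exact (hA α).2.symm
  exact ⟨A, (neg_eq_iff_eq_neg.mpr (rho_injective (h₁.trans h₂.symm))).symm, h₁⟩

theorem rho_mem_der {A : Matrix (Fin 7) (Fin 7) ℂ} (hA : Aᵀ = -A) : rho A ∈ formKTS.der := by
  intro x y z
  rw [formKTS_triple, rho_formTriple, hA]
  simp [sub_eq_add_neg]

theorem mem_stabEta_iff (A : SL7) : A ∈ stabEta ↔ A.1ᵀ = -A.1 := by
  have h : ∀ v w, eta (A.1 *ᵥ v) w + eta v (A.1 *ᵥ w) = v ⬝ᵥ ((A.1ᵀ + A.1) *ᵥ w) := fun v w => by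
    change A.1 *ᵥ v ⬝ᵥ w + v ⬝ᵥ A.1 *ᵥ w = _
    rw [Matrix.add_mulVec, dotProduct_add, Matrix.dotProduct_mulVec v A.1ᵀ, Matrix.vecMul_transpose]
  change (∀ v w, _) ↔ _
  simp only [h]
  rw [← add_eq_zero_iff_eq_neg]
  constructor
  · intro h₁
    ext i j
    simpa using h₁ (Pi.single i 1) (Pi.single j 1)
  · intro h₁ v w
    rw [h₁, Matrix.zero_mulVec, dotProduct_zero]

theorem trace_eq_zero_of_transpose_eq_neg {A : Matrix (Fin 7) (Fin 7) ℂ} (hA : Aᵀ = -A) :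
    A.trace = 0 := by
  have h := A.trace_transpose
  rw [hA, Matrix.trace_neg] at h
  exact self_eq_neg.mp h.symm

/-- The action of the stabilizer of `η` on three-forms by derivations. -/
def stabEtaToDer : stabEta →ₗ⁅ℂ⁆ formKTS.der where
  toFun A := ⟨rho A.1.1, rho_mem_der ((mem_stabEta_iff A.1).mp A.2)⟩
  map_add' A B := Subtype.ext (map_add rho A.1.1 B.1.1)
  map_smul' c A := Subtype.ext (map_smul rho c A.1.1)
  map_lie' {A B} := Subtype.ext (rho_lie A.1.1 B.1.1)

theorem stabEtaToDer_bijective : Function.Bijective stabEtaToDer := by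
  constructor
  · intro A B h
    exact Subtype.ext (Subtype.ext (rho_injective (congrArg Subtype.val h)))
  · rintro ⟨δ, hδ⟩
    obtain ⟨A, hA, rfl⟩ := exists_rho_eq_of_mem_der hδ
    exact ⟨⟨⟨A, trace_eq_zero_of_transpose_eq_neg hA⟩, (mem_stabEta_iff _).mpr hA⟩, rfl⟩

/-- The stabilizer of `η` consists of the skew-symmetric matrices. -/
def stabEtaEquivSO7 : stabEta ≃ₗ⁅ℂ⁆ SO7 where
  toFun A := ⟨A.1.1, (LieAlgebra.Orthogonal.mem_so _ _ _).mpr ((mem_stabEta_iff A.1).mp A.2)⟩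
  map_add' _ _ := rfl
  map_smul' _ _ := rfl
  map_lie' := rfl
  invFun A := ⟨⟨A.1,
    trace_eq_zero_of_transpose_eq_neg ((LieAlgebra.Orthogonal.mem_so _ _ _).mp A.2)⟩,
    (mem_stabEta_iff _).mpr ((LieAlgebra.Orthogonal.mem_so _ _ _).mp A.2)⟩
  left_inv _ := rfl
  right_inv _ := rfl

end

theorem theorem7p3 :
    ∃ T : KantorTripleSystem ThreeForm,
      (∀ α β γ : ThreeForm,
        T.triple α β γ =
          ((2 / 7 : ℂ) * eta₃ α β) • γ - formAction (bullet (sharp₃ β) α).1 γ) ∧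
      T.IsKSimple ∧
      IsTypeE7 T.TKK ∧
      (∃ e : stabEta ≃ₗ⁅ℂ⁆ T.der,
        ∀ (A : stabEta) (α : ThreeForm),
          (e A : Module.End ℂ ThreeForm) α = formAction A.1.1 α) ∧
      Nonempty (stabEta ≃ₗ⁅ℂ⁆ SO7) :=
  ⟨formKTS, formTriple_apply, formKTS_isKSimple, isTypeE7_formKTS,
    ⟨LieEquiv.ofBijective stabEtaToDer stabEtaToDer_bijective, fun _ _ => rfl⟩, ⟨stabEtaEquivSO7⟩⟩
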